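/- **Tiered multi-armed bandit with multiple source tasks.** Let $A\ge 2$, $W\ge 2$. A high-tier task $M_{\rm Hi}$ and source tasks $M_{{\rm Lo},1},\dots,M_{{\rm Lo},W}$ are stochastic bandits with common arm set $[A]$ and rewards in $[0,1]$; arm $i$ has mean $\mu_{\rm Hi}(i)$, resp. $\mu_{{\rm Lo},w}(i)$. Assume that every task has a unique optimal arm, denoted $i^*_{\rm Hi}$, $i^*_{{\rm Lo},w}$. Put $\Delta_{\rm Hi}(i)=\max_j\mu_{\rm Hi}(j)-\mu_{\rm Hi}(i)$, similarly $\Delta_{{\rm Lo},w}(i)$, and let $\Delta_{\min}>0$ be the smallest gap of a non-optimal arm over all $W+1$ tasks. Assume optimal value dominance, $\mu_{{\rm Lo},w}(i^*_{{\rm Lo},w})\ge\mu_{\rm Hi}(i^*_{\rm Hi})-\Delta_{\min}/2$ for all $w\in[W]$, and let $0\le\tilde\Delta_{\min}\le\Delta_{\min}$ be known to the learner. Call $M_{\rm Hi}$ and $M_{{\rm Lo},w}$ *$\epsilon$-close* if $\mu_{{\rm Lo},w}(i^*_{{\rm Lo},w})-\mu_{\rm Hi}(i^*_{\rm Hi})\le\epsilon$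 and $i^*_{{\rm Lo},w}=i^*_{\rm Hi}$. *Algorithm ("Trust till Failure"), parameters $\alpha>2$ and $\epsilon=\tilde\Delta_{\min}/4$.* In each round $k=1,2,\dots$ one arm is pulled in every task; $\pi^k_{\rm Hi}$ is the arm pulled in $M_{\rm Hi}$. In rounds $1,\dots,A$ each arm is pulled once in every task; set $w^A={\tt Null}$. For $k>A$ let $N^k(i)$ and $\hat\mu^k(i)$ be the number of pulls and the empirical mean of arm $i$ before round $k$ (in each task), let $f(k)=1+16WA^2(k+1)^2$, and let $\overline\mu^k(i),\underline\mu^k(i)=\hat\mu^k(i)\pm\sqrt{2\alpha\log f(k)/N^k(i)}$. In each source task $w$ pull an arm in $\arg\max_i\overline\mu^k_{{\rm Lo},w}(i)$ and let $\underline\pi^k_{{\rm Lo},w}\in\arg\max_i\underline\mu^k_{{\rm Lo},w}(i)$. Let $\mathcal I^k$ be the set of $w\in[W]$ with $\underline\mu^k_{{\rm Lo},w}(\underline\pi^k_{{\rm Lo},w})\le\overline\mu^k_{\rm Hi}(\underline\pi^k_{{\rm Lo},w})+\epsilon$ and $N^k_{{\rm Lo},w}(\underline\pi^k_{{\rm Lo},w})>k/2$.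 - If $\mathcal I^k=\emptyset$, set $w^k={\tt Null}$ and $\pi^k_{\rm Hi}\in\arg\max_i\overline\mu^k_{\rm Hi}(i)$. - Otherwise set $\pi^k_{\rm Hi}=\underline\pi^k_{{\rm Lo},w^k}$, where: $w^k=w^{k-1}$ if $w^{k-1}\ne{\tt Null}$ and $w^{k-1}\in\mathcal I^k$; else, if $w^{k-1}\neq{\tt Null}$ and some $w\in\mathcal I^k$ satisfies $\pi^{k-1}_{\rm Hi}\in\arg\max_iN^k_{{\rm Lo},w}(i)$, $w^k$ is such a $w$; else $w^k$ is drawn uniformly from $\mathcal I^k$. Ties are broken in any non-anticipating way. Let ${\rm Regret}_K(M_{\rm Hi})=\mathbb E\big[\sum_{k=1}^K(\mu_{\rm Hi}(i^*_{\rm Hi})-\mu_{\rm Hi}(\pi^k_{\rm Hi}))\big]$. **Theorem.** For every $\alpha>2$ there is a constant $C>0$ depending only on $\alpha$ such that, in the setting above, for all $K\ge1$, $$ {\rm Regret}_K(M_{\rm Hi})\le C\sum_{i:\Delta_{\rm Hi}(i)>0}\frac1{\Delta_{\rm Hi}(i)}\log(WK). $$ If moreover at least one source task is $\tilde\Delta_{\min}/4$-close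 to $M_{\rm Hi}$, then for all $K\ge1$, $$ {\rm Regret}_K(M_{\rm Hi})\le C\sum_{i:\Delta_{\rm Hi}(i)>0}\frac1{\Delta_{\rm Hi}(i)}\log\frac{AW}{\Delta_{\min}}, $$ a bound independent of $K$. -/

import Mathlib

open MeasureTheory ProbabilityTheory

noncomputable section

/-- A stochastic bandit task with arms `Fin A`: pulling arm `i` yields a reward with distribution
`law i`, a probability distribution on `[0, 1]`. -/
structure BanditTask (A : ℕ) where
  law : Fin A → Measure ℝ
  isProb : ∀ i, IsProbabilityMeasure (law i)
  mem_Icc : ∀ i, ∀ᵐ x ∂(law i), x ∈ Set.Icc (0 : ℝ) 1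

namespace BanditTask

variable {A W : ℕ}

/-- Expected reward of arm `i`. -/
def mean (M : BanditTask A) (i : Fin A) : ℝ := ∫ x, x ∂(M.law i)

/-- The optimal value `max_i mean i`. -/
def optValue (M : BanditTask A) : ℝ := ⨆ i, M.mean i

/-- The gap of arm `i`. -/
def gap (M : BanditTask A) (i : Fin A) : ℝ := M.optValue - M.mean i

/-- Arm `i` has the largest expected reward. -/
def IsOptimal (M : BanditTask A) (i : Fin A) : Prop := ∀ j, M.mean j ≤ M.mean i

/-- The smallest gap of a non-optimal arm. -/
def minGap (M : BanditTask A) : ℝ := ⨅ i : {i : Fin A // ¬ M.IsOptimal i}, M.gap i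

/-- The smallest gap over the high-tier task and all source tasks. -/
def jointMinGap (Hi : BanditTask A) (Lo : Fin W → BanditTask A) : ℝ :=
  min Hi.minGap (⨅ w, (Lo w).minGap)

/-- `Hi` is `ε`-close to `Lo`: the optimal value of `Lo` exceeds that of `Hi` by at most `ε`,
and both tasks have the same optimal arms. -/
def IsClose (ε : ℝ) (Hi Lo : BanditTask A) : Prop :=
  Lo.optValue - Hi.optValue ≤ ε ∧ ∀ i, Hi.IsOptimal i ↔ Lo.IsOptimal i

end BanditTask

section Statistics

variable {A : ℕ} {Ω : Type*}

/-- Number of pulls of arm `i` in the rounds `1, …, k - 1`. -/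
def pullCount (arm : ℕ → Ω → Fin A) (k : ℕ) (i : Fin A) (ω : Ω) : ℕ :=
  ((Finset.Ico 1 k).filter fun j => arm j ω = i).card

/-- Empirical mean of the rewards of arm `i` over the rounds `1, …, k - 1`
(`0` if arm `i` has not been pulled). -/
def empMean (arm : ℕ → Ω → Fin A) (rew : ℕ → Ω → ℝ) (k : ℕ) (i : Fin A) (ω : Ω) : ℝ :=
  (∑ j ∈ (Finset.Ico 1 k).filter (fun j => arm j ω = i), rew j ω) / (pullCount arm k i ω : ℝ)

/-- `f(k) = 1 + 16 W A² (k + 1)²`. -/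
def confFn (A W k : ℕ) : ℝ := 1 + 16 * (W : ℝ) * (A : ℝ) ^ 2 * ((k : ℝ) + 1) ^ 2

/-- The confidence width `√(2 α log f(k) / N^k(i))`. -/
def confWidth (α : ℝ) (W : ℕ) (arm : ℕ → Ω → Fin A) (k : ℕ) (i : Fin A) (ω : Ω) : ℝ :=
  Real.sqrt (2 * α * Real.log (confFn A W k) / (pullCount arm k i ω : ℝ))

/-- Upper confidence bound of arm `i` at the beginning of round `k`. -/
def ucb (α : ℝ) (W : ℕ) (arm : ℕ → Ω → Fin A) (rew : ℕ → Ω → ℝ) (k : ℕ) (i : Fin A) (ω : Ω) : ℝ :=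
  empMean arm rew k i ω + confWidth α W arm k i ω

/-- Lower confidence bound of arm `i` at the beginning of round `k`. -/
def lcb (α : ℝ) (W : ℕ) (arm : ℕ → Ω → Fin A) (rew : ℕ → Ω → ℝ) (k : ℕ) (i : Fin A) (ω : Ω) : ℝ :=
  empMean arm rew k i ω - confWidth α W arm k i ω

/-- Conditionally on the information `m`, the variable `X` has distribution `κ ω`. -/
def HasCondLaw [MeasurableSpace Ω] (P : Measure Ω) (m : MeasurableSpace Ω) (X : Ω → ℝ)
    (κ : Ω → Measure ℝ) : Prop :=
  ∀ B : Set ℝ, MeasurableSet B → P⟦X ⁻¹' B|m⟧ =ᵐ[P] fun ω => (κ ω).real B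

end Statistics

/-- The random quantities produced while interacting with one high-tier task and `W` source tasks.
Rounds are numbered `1, 2, 3, …`; the values at index `0` play no role. -/
structure TieredTrace (A W : ℕ) (Ω : Type*) where
  /-- arm pulled in source task `w` in round `k` -/
  armLo : Fin W → ℕ → Ω → Fin A
  /-- reward received from source task `w` in round `k` -/
  rewLo : Fin W → ℕ → Ω → ℝ
  /-- the arm of source task `w` maximising the lower confidence bound in round `k` -/
  lcbArm : Fin W → ℕ → Ω → Fin A
  /-- the trusted source task in round `k`, where `none` stands for `Null` -/
  task : ℕ → Ω → Option (Fin W)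
  /-- arm pulled in the high-tier task in round `k` -/
  armHi : ℕ → Ω → Fin A
  /-- reward received from the high-tier task in round `k` -/
  rewHi : ℕ → Ω → ℝ

namespace TieredTrace

variable {A W : ℕ} {Ω : Type*}

/-- Information generated by the decisions of round `k`. -/
abbrev decisionInfo (T : TieredTrace A W Ω) (k : ℕ) : MeasurableSpace Ω :=
  (⨆ w, MeasurableSpace.comap (T.armLo w k) ⊤) ⊔ (⨆ w, MeasurableSpace.comap (T.lcbArm w k) ⊤) ⊔
    MeasurableSpace.comap (T.task k) ⊤ ⊔ MeasurableSpace.comap (T.armHi k) ⊤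

/-- Information generated by the rewards of round `k`. -/
abbrev rewardInfo (T : TieredTrace A W Ω) (k : ℕ) : MeasurableSpace Ω :=
  (⨆ w, MeasurableSpace.comap (T.rewLo w k) inferInstance) ⊔
    MeasurableSpace.comap (T.rewHi k) inferInstance

/-- The history before round `k`: all decisions and rewards of the rounds `1, …, k - 1`. -/
abbrev history (T : TieredTrace A W Ω) (k : ℕ) : MeasurableSpace Ω :=
  ⨆ j ∈ Finset.Ico 1 k, (T.decisionInfo j ⊔ T.rewardInfo j)

/-- The set `I^k` of source tasks that pass the checking event in round `k`. -/
def passing (T : TieredTrace A W Ω) (α ε : ℝ) (k : ℕ) (ω : Ω) : Finset (Fin W) :=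
  Finset.univ.filter fun w =>
    lcb α W (T.armLo w) (T.rewLo w) k (T.lcbArm w k ω) ω ≤
        ucb α W T.armHi T.rewHi k (T.lcbArm w k ω) ω + ε ∧
      (k : ℝ) / 2 < (pullCount (T.armLo w) k (T.lcbArm w k ω) ω : ℝ)

/-- The previously trusted task is still in `I^k`. -/
def CanKeep (T : TieredTrace A W Ω) (α ε : ℝ) (k : ℕ) (ω : Ω) : Prop :=
  ∃ w ∈ T.passing α ε k ω, T.task (k - 1) ω = some w

/-- Task `w` is in `I^k`, and the high-tier arm of round `k - 1` is its most pulled arm. -/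
def Inherits (T : TieredTrace A W Ω) (α ε : ℝ) (k : ℕ) (ω : Ω) (w : Fin W) : Prop :=
  w ∈ T.passing α ε k ω ∧
    ∀ i, pullCount (T.armLo w) k i ω ≤ pullCount (T.armLo w) k (T.armHi (k - 1) ω) ω

/-- In round `k` the trusted task is drawn uniformly from `I^k`: the set `I^k` is nonempty and
neither the previous task nor the previous action can be kept. -/
def Resamples (T : TieredTrace A W Ω) (α ε : ℝ) (k : ℕ) (ω : Ω) : Prop :=
  (T.passing α ε k ω).Nonempty ∧ ¬ T.CanKeep α ε k ω ∧
    ¬ (T.task (k - 1) ω ≠ none ∧ ∃ w, T.Inherits α ε k ω w)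

/-- `T` is a run of the "Trust till Failure" algorithm with parameters `α` and `ε` on the
high-tier task `Hi` and the source tasks `Lo`, on the probability space `(Ω, P)`.
Ties in every `argmax` (and the choice among several tasks that recommend the previous action)
are broken in an arbitrary, possibly random, non-anticipating way. The joint law of the rewards
that different tasks give in the same round is left free; independent rewards are one case. -/
structure IsTrustRun [MeasurableSpace Ω] (T : TieredTrace A W Ω) (P : Measure Ω) (α ε : ℝ)
    (Hi : BanditTask A) (Lo : Fin W → BanditTask A) : Prop where
  measurable_armLo : ∀ w k, Measurable (T.armLo w k)
  measurable_rewLo : ∀ w k, Measurable (T.rewLo w k)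
  measurable_lcbArm : ∀ w k, Measurable (T.lcbArm w k)
  measurable_task : ∀ k, Measurable[_, ⊤] (T.task k)
  measurable_armHi : ∀ k, Measurable (T.armHi k)
  measurable_rewHi : ∀ k, Measurable (T.rewHi k)
  /-- Given the history and the decisions of round `k`, the reward of source task `w` follows the
  law of the pulled arm. -/
  law_rewLo : ∀ w k, 1 ≤ k → HasCondLaw P (T.history k ⊔ T.decisionInfo k) (T.rewLo w k)
    fun ω => (Lo w).law (T.armLo w k ω)
  /-- Given the history and the decisions of round `k`, the reward of the high-tier task follows
  the law of the pulled arm. -/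
  law_rewHi : ∀ k, 1 ≤ k → HasCondLaw P (T.history k ⊔ T.decisionInfo k) (T.rewHi k)
    fun ω => Hi.law (T.armHi k ω)
  /-- Each arm of each task is pulled (hence exactly once) in the rounds `1, …, A`. -/
  init_armLo : ∀ w ω i, ∃ k ∈ Finset.Icc 1 A, T.armLo w k ω = i
  init_armHi : ∀ ω i, ∃ k ∈ Finset.Icc 1 A, T.armHi k ω = i
  init_task : ∀ ω, T.task A ω = none
  /-- Every source task is played by UCB. -/
  armLo_ucb : ∀ w k, A < k → ∀ ω i,
    ucb α W (T.armLo w) (T.rewLo w) k i ω ≤ ucb α W (T.armLo w) (T.rewLo w) k (T.armLo w k ω) ω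
  lcbArm_lcb : ∀ w k, A < k → ∀ ω i,
    lcb α W (T.armLo w) (T.rewLo w) k i ω ≤ lcb α W (T.armLo w) (T.rewLo w) k (T.lcbArm w k ω) ω
  /-- If no source task passes the check, none is trusted. -/
  task_none : ∀ k, A < k → ∀ ω, T.passing α ε k ω = ∅ → T.task k ω = none
  /-- A trusted task is kept as long as it passes the check. -/
  task_keep : ∀ k, A < k → ∀ ω, T.CanKeep α ε k ω → T.task k ω = T.task (k - 1) ω
  /-- When the trusted task fails, a passing task recommending the previous action is preferred. -/
  task_inherit : ∀ k, A < k → ∀ ω, ¬ T.CanKeep α ε k ω → T.task (k - 1) ω ≠ none →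
    (∃ w, T.Inherits α ε k ω w) → ∃ w, T.Inherits α ε k ω w ∧ T.task k ω = some w
  /-- Otherwise the trusted task is drawn uniformly from `I^k`. -/
  task_resample : ∀ k, A < k → ∀ ω, T.Resamples α ε k ω →
    ∃ w ∈ T.passing α ε k ω, T.task k ω = some w
  task_uniform : ∀ k, A < k → ∀ w, ∀ᵐ ω ∂P, T.Resamples α ε k ω → w ∈ T.passing α ε k ω →
    (P⟦{ω' | T.task k ω' = some w}|
      T.history k ⊔ ⨆ v, MeasurableSpace.comap (T.lcbArm v k) ⊤⟧) ω =
        1 / ((T.passing α ε k ω).card : ℝ)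
  /-- If a task is trusted, its lower-confidence arm is pulled in the high-tier task. -/
  armHi_trust : ∀ k, A < k → ∀ ω w, T.task k ω = some w → T.armHi k ω = T.lcbArm w k ω
  /-- If no task is trusted, the high-tier task is played by UCB. -/
  armHi_ucb : ∀ k, A < k → ∀ ω, T.task k ω = none → ∀ i,
    ucb α W T.armHi T.rewHi k i ω ≤ ucb α W T.armHi T.rewHi k (T.armHi k ω) ω

/-- The pseudo-regret `E[∑_{k=1}^K (max_i μ_Hi(i) - μ_Hi(π_Hi^k))]` in the high-tier task. -/
def regretHi [MeasurableSpace Ω] (T : TieredTrace A W Ω) (P : Measure Ω) (Hi : BanditTask A)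
    (K : ℕ) : ℝ :=
  ∫ ω, ∑ k ∈ Finset.Icc 1 K, (Hi.optValue - Hi.mean (T.armHi k ω)) ∂P

end TieredTrace

/-- `∑_{i : Δ(i) > 0} 1 / Δ(i)`. -/
def BanditTask.invGapSum {A : ℕ} (M : BanditTask A) : ℝ :=
  ∑ i ∈ Finset.univ.filter (fun i => 0 < M.gap i), 1 / M.gap i

end

/-!
A Hoeffding bound for the predictable pulls and a union bound over tasks, arms and rounds show that
all confidence intervals are correct in all rounds of `[k / 8, k]` with probability at least
`1 - 8 / k ^ 2`; the failures are summable and contribute a constant to the regret.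

While the intervals are correct, an arm pulled in the high-tier task has a gap of the order of its
own confidence width. In a round without a trusted source this is the usual optimism argument. In
a trusted round the arm is the lower-confidence arm of a source which has pulled it in more than
half of the rounds, its lower bound there is below its upper bound in the high-tier task up to
`ε`, and optimal value dominance turns this into a bound on the gap. Hence a suboptimal arm is
pulled `O(log (W K) / Δ ^ 2)` times.

If some source is close, then after a polynomial number of rounds it has pulled its optimal arm,
which is the optimal arm of the high-tier task, most of the time, so it passes the test in every
round. By the logarithmic bound the optimal arm is also pulled in the high-tier task in some round
of `[k / 2, k]`. A passing source has pulled its lower-confidence arm in more than half of the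
rounds, so this arm does not change from one round to the next while the source passes; when the
trusted source fails, the close source allows a switch to another source with the same majority
arm. So the optimal arm, once pulled, is pulled until round `k`.
-/

section ConditionalLaw

variable {Ω : Type*} {m mΩ : MeasurableSpace Ω} {P : Measure Ω} [IsFiniteMeasure P]
  {X : Ω → ℝ} {κ : Ω → Measure ℝ} {ν : Measure ℝ} [IsFiniteMeasure ν] {G : Set Ω}

lemma HasCondLaw.map_restrict (h : HasCondLaw P m X κ) (hm : m ≤ mΩ) (hX : Measurable X)
    (hG : MeasurableSet[m] G) (hκ : ∀ ω ∈ G, κ ω = ν) :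
    (P.restrict G).map X = P G • ν := by
  ext B hB
  have hcond : ∫ ω in G, (P⟦X ⁻¹' B|m⟧) ω ∂P = P.real G * ν.real B := by
    have hae : ∀ᵐ ω ∂P, ω ∈ G → (P⟦X ⁻¹' B|m⟧) ω = ν.real B := by
      filter_upwards [h B hB] with ω hω hmem
      rw [hω, hκ ω hmem]
    rw [setIntegral_congr_ae (hm G hG) hae, setIntegral_const, smul_eq_mul]
  have hind : ∫ ω in G, (P⟦X ⁻¹' B|m⟧) ω ∂P = P.real (X ⁻¹' B ∩ G) := by
    rw [setIntegral_condExp hm ((integrable_const 1).indicator (hX hB)) hG,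
      integral_indicator (hX hB), setIntegral_const, smul_eq_mul, mul_one,
      measureReal_restrict_apply (hX hB)]
  rw [Measure.map_apply hX hB, Measure.restrict_apply (hX hB), Measure.smul_apply, smul_eq_mul,
    ← ENNReal.toReal_eq_toReal_iff' (measure_ne_top _ _)
      (ENNReal.mul_ne_top (measure_ne_top _ _) (measure_ne_top _ _)), ENNReal.toReal_mul]
  exact hind.symm.trans hcond

lemma HasCondLaw.setLIntegral_mul_comp (h : HasCondLaw P m X κ) (hm : m ≤ mΩ) (hX : Measurable X)
    (hG : MeasurableSet[m] G) (hκ : ∀ ω ∈ G, κ ω = ν) {Y : Ω → ENNReal} (hY : Measurable[m] Y)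
    {g : ℝ → ENNReal} (hg : Measurable g) :
    ∫⁻ ω in G, Y ω * g (X ω) ∂P = (∫⁻ ω in G, Y ω ∂P) * ∫⁻ x, g x ∂ν := by
  have hgX : Measurable fun ω => g (X ω) := hg.comp hX
  refine Measurable.ennreal_induction (motive := fun Y => ∫⁻ ω in G, Y ω * g (X ω) ∂P
      = (∫⁻ ω in G, Y ω ∂P) * ∫⁻ x, g x ∂ν) (fun c s hs => ?indicator)
    (fun f g' _ hf _ ihf ihg => ?add) (fun f hf hmono ih => ?iSup) hY
  case indicator =>
    have hmul : (fun ω => s.indicator (fun _ => c) ω * g (X ω))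
        = s.indicator fun ω => c * g (X ω) := by
      ext ω; by_cases hω : ω ∈ s <;> simp [hω]
    rw [hmul, lintegral_indicator (hm _ hs), lintegral_indicator (hm _ hs),
      Measure.restrict_restrict (hm _ hs), lintegral_const_mul _ hgX, ← lintegral_map hg hX,
      h.map_restrict hm hX (hs.inter hG) fun ω hω => hκ ω hω.2, lintegral_smul_measure,
      setLIntegral_const, smul_eq_mul, mul_assoc]
  case add =>
    have hf' : Measurable f := hf.mono hm le_rfl
    have hfg : Measurable fun ω => f ω * g (X ω) := hf'.mul hgX
    simp only [Pi.add_apply, add_mul]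
    rw [lintegral_add_left hfg, lintegral_add_left hf', ihf, ihg, add_mul]
  case iSup =>
    have hf' : ∀ n, Measurable (f n) := fun n => (hf n).mono hm le_rfl
    have hfg : ∀ n, Measurable fun ω => f n ω * g (X ω) := fun n => (hf' n).mul hgX
    have hmono' : Monotone fun n ω => f n ω * g (X ω) := fun a b hab ω =>
      mul_le_mul_left (hmono hab ω) _
    simp only [ENNReal.iSup_mul]
    rw [lintegral_iSup hf' hmono, lintegral_iSup hfg hmono', ENNReal.iSup_mul]
    exact iSup_congr ih

end ConditionalLaw

lemma lintegral_exp_mul_sub_le_one {Ω : Type*} [MeasurableSpace Ω] {μ : Measure Ω} {X : Ω → ℝ}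
    {c : NNReal} (h : HasSubgaussianMGF X c μ) (t : ℝ) :
    ∫⁻ ω, ENNReal.ofReal (Real.exp (t * X ω - c * t ^ 2 / 2)) ∂μ ≤ 1 := by
  simp only [Real.exp_sub]
  rw [← ofReal_integral_eq_lintegral_ofReal ((h.integrable_exp_mul t).div_const _)
    (ae_of_all _ fun x => by positivity), integral_div]
  exact ENNReal.ofReal_le_one.2 ((div_le_one (Real.exp_pos _)).2 (h.mgf_le t))

namespace BanditTask

variable {A W : ℕ} (M : BanditTask A)

instance (i : Fin A) : IsProbabilityMeasure (M.law i) := M.isProb i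

lemma hasSubgaussianMGF_law (i : Fin A) :
    HasSubgaussianMGF (fun x => x - M.mean i) (1 / 4) (M.law i) := by
  have h := hasSubgaussianMGF_of_mem_Icc (X := id) aemeasurable_id (M.mem_Icc i)
  norm_num at h
  exact h

lemma mean_mem_Icc (i : Fin A) : M.mean i ∈ Set.Icc (0 : ℝ) 1 := by
  have hint : Integrable (fun x : ℝ => x) (M.law i) :=
    Integrable.of_mem_Icc 0 1 aemeasurable_id (M.mem_Icc i)
  refine ⟨integral_nonneg_of_ae ((M.mem_Icc i).mono fun x hx => hx.1), ?_⟩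
  simpa [mean] using
    integral_mono_ae hint (integrable_const (1 : ℝ)) ((M.mem_Icc i).mono fun x hx => hx.2)

lemma mean_le_optValue (i : Fin A) : M.mean i ≤ M.optValue :=
  le_ciSup (Set.finite_range M.mean).bddAbove i

lemma gap_nonneg (i : Fin A) : 0 ≤ M.gap i := sub_nonneg.2 (M.mean_le_optValue i)

lemma gap_le_one (i : Fin A) : M.gap i ≤ 1 := by
  have : Nonempty (Fin A) := ⟨i⟩
  have hopt : M.optValue ≤ 1 := ciSup_le fun j => (M.mean_mem_Icc j).2
  have := (M.mean_mem_Icc i).1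
  rw [gap]; linarith

lemma exists_isOptimal [Nonempty (Fin A)] : ∃ i, M.IsOptimal i := Finite.exists_max M.mean

variable {M}

lemma IsOptimal.mean_eq {i : Fin A} (h : M.IsOptimal i) : M.mean i = M.optValue :=
  have : Nonempty (Fin A) := ⟨i⟩
  le_antisymm (M.mean_le_optValue i) (ciSup_le h)

lemma IsOptimal.gap_eq_zero {i : Fin A} (h : M.IsOptimal i) : M.gap i = 0 := by
  rw [gap, h.mean_eq, sub_self]

lemma gap_pos_iff {i : Fin A} : 0 < M.gap i ↔ ¬ M.IsOptimal i := by
  refine ⟨fun h h' => h.ne' h'.gap_eq_zero, fun h => (M.gap_nonneg i).lt_of_ne' fun h0 => h ?_⟩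
  intro j
  have := M.mean_le_optValue j
  rw [gap] at h0
  linarith

lemma invGapSum_nonneg (M : BanditTask A) : 0 ≤ M.invGapSum :=
  Finset.sum_nonneg fun i _ => one_div_nonneg.2 (M.gap_nonneg i)

lemma one_le_invGapSum {i : Fin A} (h : ¬ M.IsOptimal i) : 1 ≤ M.invGapSum := by
  have hpos := gap_pos_iff.2 h
  calc (1 : ℝ) ≤ 1 / M.gap i := (one_le_div hpos).2 (M.gap_le_one i)
    _ ≤ M.invGapSum := Finset.single_le_sum (f := fun j => 1 / M.gap j)
        (fun j _ => one_div_nonneg.2 (M.gap_nonneg j))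
        (Finset.mem_filter.2 ⟨Finset.mem_univ i, hpos⟩)

/-- `D` bounds the positive gaps of `M` from below. Unlike the value `M.minGap`, which is the junk
value `0` when every arm is optimal, this is meaningful for every task. -/
def IsGapLowerBound (M : BanditTask A) (D : ℝ) : Prop :=
  ∀ i, ¬ M.IsOptimal i → D ≤ M.gap i

lemma isGapLowerBound_minGap (M : BanditTask A) : M.IsGapLowerBound M.minGap := fun i h =>
  ciInf_le (Set.finite_range fun i : {i : Fin A // ¬ M.IsOptimal i} => M.gap i).bddBelow ⟨i, h⟩

lemma IsGapLowerBound.mono {D D' : ℝ} (h : M.IsGapLowerBound D) (hD : D' ≤ D) :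
    M.IsGapLowerBound D' := fun i hi => hD.trans (h i hi)

/-- Optimal value dominance: no source task has an optimal value more than `D / 2` below that of
the high-tier task, where `D` is a lower bound for the positive gaps of the latter. -/
structure OptValueDominance (D : ℝ) (Hi : BanditTask A) (Lo : Fin W → BanditTask A) : Prop where
  isGapLowerBound : Hi.IsGapLowerBound D
  sub_le_optValue : ∀ w, Hi.optValue - D / 2 ≤ (Lo w).optValue

section JointMinGap

variable (Hi : BanditTask A) (Lo : Fin W → BanditTask A)

lemma isGapLowerBound_jointMinGap : Hi.IsGapLowerBound (jointMinGap Hi Lo) :=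
  Hi.isGapLowerBound_minGap.mono (min_le_left _ _)

lemma isGapLowerBound_jointMinGap_source (w : Fin W) :
    (Lo w).IsGapLowerBound (jointMinGap Hi Lo) :=
  (Lo w).isGapLowerBound_minGap.mono
    ((min_le_right _ _).trans (ciInf_le (Set.finite_range _).bddBelow w))

end JointMinGap

lemma exists_not_isOptimal (hA : 2 ≤ A) (h : ∃! i, M.IsOptimal i) : ∃ i, ¬ M.IsOptimal i := by
  have : Nontrivial (Fin A) := Fin.nontrivial_iff_two_le.2 hA
  obtain ⟨i, -, hu⟩ := h
  obtain ⟨j, hj⟩ := exists_ne i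
  exact ⟨j, fun h' => hj (hu j h')⟩

lemma minGap_pos (h : ∃ i, ¬ M.IsOptimal i) : 0 < M.minGap := by
  have : Nonempty {i : Fin A // ¬ M.IsOptimal i} := nonempty_subtype.2 h
  obtain ⟨i, hi⟩ :=
    exists_eq_ciInf_of_finite (f := fun i : {i : Fin A // ¬ M.IsOptimal i} => M.gap i)
  rw [minGap, ← hi]
  exact gap_pos_iff.2 i.2

lemma jointMinGap_pos [Nonempty (Fin W)] {Hi : BanditTask A} {Lo : Fin W → BanditTask A}
    (hHi : ∃ i, ¬ Hi.IsOptimal i) (hLo : ∀ w, ∃ i, ¬ (Lo w).IsOptimal i) :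
    0 < jointMinGap Hi Lo := by
  obtain ⟨w, hw⟩ := exists_eq_ciInf_of_finite (f := fun w => (Lo w).minGap)
  rw [jointMinGap, ← hw]
  exact lt_min (minGap_pos hHi) (minGap_pos (hLo w))

end BanditTask

section PullCount

variable {A : ℕ} {Ω : Type*} {arm : ℕ → Ω → Fin A} {ω : Ω}

lemma pullCount_succ (arm : ℕ → Ω → Fin A) {k : ℕ} (hk : 1 ≤ k) (i : Fin A) (ω : Ω) :
    pullCount arm (k + 1) i ω = pullCount arm k i ω + if arm k ω = i then 1 else 0 := by
  simp only [pullCount, Finset.card_filter]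
  rw [Finset.sum_Ico_succ_top hk]

lemma pullCount_le (arm : ℕ → Ω → Fin A) (k : ℕ) (i : Fin A) (ω : Ω) :
    pullCount arm k i ω ≤ k - 1 := by
  simpa [pullCount] using Finset.card_filter_le (Finset.Ico 1 k) fun j => arm j ω = i

lemma pullCount_mono (arm : ℕ → Ω → Fin A) {k k' : ℕ} (h : k ≤ k') (i : Fin A) (ω : Ω) :
    pullCount arm k i ω ≤ pullCount arm k' i ω :=
  Finset.card_le_card (Finset.filter_subset_filter _ (Finset.Ico_subset_Ico_right h))

lemma sum_pullCount (arm : ℕ → Ω → Fin A) (k : ℕ) (ω : Ω) :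
    ∑ i, pullCount arm k i ω = k - 1 := by
  rw [← Nat.card_Ico 1 k]
  exact (Finset.card_eq_sum_card_fiberwise (f := fun j => arm j ω) (t := Finset.univ)
    fun _ _ => Finset.mem_univ _).symm

lemma eq_of_lt_pullCount_add_pullCount {k : ℕ} {a b : Fin A}
    (h : k - 1 < pullCount arm k a ω + pullCount arm k b ω) : a = b := by
  by_contra hab
  have hle : ∑ i ∈ {a, b}, pullCount arm k i ω ≤ ∑ i, pullCount arm k i ω :=
    Finset.sum_le_sum_of_subset (Finset.subset_univ _)
  rw [Finset.sum_pair hab, sum_pullCount] at hle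
  omega

lemma strictMonoOn_pullCount (a : Fin A) :
    StrictMonoOn (fun k => pullCount arm k a ω) {k | 1 ≤ k ∧ arm k ω = a} := by
  rintro j ⟨hj, rfl⟩ k - hjk
  calc pullCount arm j (arm j ω) ω < pullCount arm (j + 1) (arm j ω) ω := by
        simp [pullCount_succ arm hj]
    _ ≤ pullCount arm k (arm j ω) ω := pullCount_mono arm hjk _ _

lemma exists_last_pull {k : ℕ} {a : Fin A} (h : 1 ≤ pullCount arm k a ω) :
    ∃ j, 1 ≤ j ∧ j < k ∧ arm j ω = a ∧ pullCount arm k a ω = pullCount arm j a ω + 1 := by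
  induction k with
  | zero => simp [pullCount] at h
  | succ k ih =>
    rcases Nat.eq_zero_or_pos k with rfl | hk
    · simp [pullCount] at h
    have hsucc := pullCount_succ arm hk a ω
    by_cases ha : arm k ω = a
    · exact ⟨k, hk, Nat.lt_succ_self k, ha, by rw [hsucc, if_pos ha]⟩
    · rw [if_neg ha, add_zero] at hsucc
      obtain ⟨j, hj1, hjk, hja, hj⟩ := ih (hsucc ▸ h)
      exact ⟨j, hj1, hjk.trans (Nat.lt_succ_self k), hja, hsucc.trans hj⟩

/-- Along the sample path `ω`, the rounds `1, …, A` pull each of the `A` arms. -/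
def TriesEveryArm (arm : ℕ → Ω → Fin A) (ω : Ω) : Prop :=
  ∀ i, ∃ k ∈ Finset.Icc 1 A, arm k ω = i

lemma TriesEveryArm.one_le_pullCount (h : TriesEveryArm arm ω) {k : ℕ} (hk : A < k) (i : Fin A) :
    1 ≤ pullCount arm k i ω := by
  obtain ⟨j, hj, hji⟩ := h i
  rw [Finset.mem_Icc] at hj
  exact Finset.card_pos.2 ⟨j, Finset.mem_filter.2 ⟨Finset.mem_Ico.2 ⟨hj.1, by omega⟩, hji⟩⟩

lemma TriesEveryArm.pullCount_eq_zero (h : TriesEveryArm arm ω) {k : ℕ} (hk : 1 ≤ k)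
    (hkA : k ≤ A) : pullCount arm k (arm k ω) ω = 0 := by
  have hle : ∀ i ∈ Finset.univ, 1 ≤ pullCount arm (A + 1) i ω := fun i _ =>
    h.one_le_pullCount (Nat.lt_succ_self A) i
  have hsum : ∑ _i : Fin A, 1 = ∑ i, pullCount arm (A + 1) i ω := by simp [sum_pullCount]
  have hone := (Finset.sum_eq_sum_iff_of_le hle).1 hsum (arm k ω) (Finset.mem_univ _)
  have hsucc := pullCount_succ arm hk (arm k ω) ω
  have hmono := pullCount_mono arm (Nat.succ_le_succ hkA) (arm k ω) ω
  rw [if_pos rfl] at hsucc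
  simp only [Nat.succ_eq_add_one] at hmono
  omega

lemma card_pulls_le {S : Finset ℕ} {a : Fin A} {m : ℝ} (hm : 0 ≤ m)
    (hS : ∀ k ∈ S, 1 ≤ k ∧ arm k ω = a ∧ (pullCount arm k a ω : ℝ) ≤ m) : (S.card : ℝ) ≤ m + 1 := by
  have hpulls : (S : Set ℕ) ⊆ {k | 1 ≤ k ∧ arm k ω = a} := fun k hk =>
    ⟨(hS k hk).1, (hS k hk).2.1⟩
  have hcard : S.card ≤ (Finset.range (⌊m⌋₊ + 1)).card := by
    refine Finset.card_le_card_of_injOn (fun k => pullCount arm k a ω) (fun k hk => ?_)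
      ((strictMonoOn_pullCount a).injOn.mono hpulls)
    simpa using Nat.lt_succ_of_le (Nat.le_floor (hS k hk).2.2)
  rw [Finset.card_range] at hcard
  calc (S.card : ℝ) ≤ ((⌊m⌋₊ + 1 : ℕ) : ℝ) := Nat.cast_le.2 hcard
    _ ≤ m + 1 := by push_cast; gcongr; exact Nat.floor_le hm

variable {M : BanditTask A} {c : ℝ} {S : Finset ℕ}

lemma card_pulls_le_of_gap (hc : 0 ≤ c) {a : Fin A} {D : ℝ} (hD : 0 < D) (ha : D ≤ M.gap a)
    (hS : ∀ k ∈ S, 1 ≤ k ∧ pullCount arm k (arm k ω) ω * M.gap (arm k ω) ^ 2 ≤ c) :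
    ((S.filter fun k => arm k ω = a).card : ℝ) ≤ c / D ^ 2 + 1 := by
  refine card_pulls_le (arm := arm) (ω := ω) (a := a) (by positivity) fun k hk => ?_
  obtain ⟨hkS, rfl⟩ := Finset.mem_filter.1 hk
  obtain ⟨hk1, hle⟩ := hS k hkS
  refine ⟨hk1, rfl, (le_div_iff₀ (by positivity)).2 (le_trans ?_ hle)⟩
  gcongr

lemma card_suboptimal_le {D : ℝ} (hD : 0 < D) (hgap : M.IsGapLowerBound D) (hc : 0 ≤ c)
    (hS : ∀ k ∈ S, 1 ≤ k ∧ pullCount arm k (arm k ω) ω * M.gap (arm k ω) ^ 2 ≤ c)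
    (hsub : ∀ k ∈ S, ¬ M.IsOptimal (arm k ω)) :
    (S.card : ℝ) ≤ A * (c / D ^ 2 + 1) := by
  rw [Finset.card_eq_sum_card_fiberwise (f := fun k => arm k ω) (t := Finset.univ)
    fun _ _ => Finset.mem_univ _, Nat.cast_sum]
  calc ∑ a, ((S.filter fun k => arm k ω = a).card : ℝ) ≤ ∑ _a : Fin A, (c / D ^ 2 + 1) := by
        refine Finset.sum_le_sum fun a _ => ?_
        by_cases ha : M.IsOptimal a
        · have hempty : S.filter (fun k => arm k ω = a) = ∅ :=
            Finset.filter_eq_empty_iff.2 fun k hk h => hsub k hk (h ▸ ha)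
          rw [hempty]
          simp only [Finset.card_empty, Nat.cast_zero]
          positivity
        · exact card_pulls_le_of_gap hc hD (hgap a ha) hS
    _ = A * (c / D ^ 2 + 1) := by
        rw [Finset.sum_const, Finset.card_univ, Fintype.card_fin, nsmul_eq_mul]

lemma sum_gap_le (hc : 0 ≤ c)
    (hS : ∀ k ∈ S, 1 ≤ k ∧ pullCount arm k (arm k ω) ω * M.gap (arm k ω) ^ 2 ≤ c) :
    ∑ k ∈ S, M.gap (arm k ω) ≤ (c + 1) * M.invGapSum := by
  have hpulls : ∀ a, 0 < M.gap a →
      ((S.filter fun k => arm k ω = a).card : ℝ) * M.gap a ≤ (c + 1) * (1 / M.gap a) := by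
    intro a ha
    have hle := M.gap_le_one a
    calc ((S.filter fun k => arm k ω = a).card : ℝ) * M.gap a
        ≤ (c / M.gap a ^ 2 + 1) * M.gap a := by
          gcongr; exact card_pulls_le_of_gap hc ha le_rfl hS
      _ = c * (1 / M.gap a) + M.gap a := by field_simp
      _ ≤ c * (1 / M.gap a) + 1 / M.gap a := by
          gcongr; exact hle.trans ((one_le_div ha).2 hle)
      _ = (c + 1) * (1 / M.gap a) := by ring
  calc ∑ k ∈ S, M.gap (arm k ω)
      = ∑ a, ∑ k ∈ S.filter (fun k => arm k ω = a), M.gap (arm k ω) :=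
        (Finset.sum_fiberwise S (fun k => arm k ω) fun k => M.gap (arm k ω)).symm
    _ = ∑ a, ((S.filter fun k => arm k ω = a).card : ℝ) * M.gap a := by
        refine Finset.sum_congr rfl fun a _ => ?_
        rw [Finset.sum_congr rfl fun k hk => by rw [(Finset.mem_filter.1 hk).2],
          Finset.sum_const, nsmul_eq_mul]
    _ = ∑ a with 0 < M.gap a, ((S.filter fun k => arm k ω = a).card : ℝ) * M.gap a := by
        refine (Finset.sum_filter_of_ne fun a _ ha => ?_).symm
        exact (M.gap_nonneg a).lt_of_ne' (right_ne_zero_of_mul ha)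
    _ ≤ ∑ a with 0 < M.gap a, (c + 1) * (1 / M.gap a) :=
        Finset.sum_le_sum fun a ha => hpulls a (Finset.mem_filter.1 ha).2
    _ = (c + 1) * M.invGapSum := by rw [BanditTask.invGapSum, Finset.mul_sum]

end PullCount

section ConfFn

lemma one_le_confFn (A W k : ℕ) : 1 ≤ confFn A W k := by
  unfold confFn; exact le_add_of_nonneg_right (by positivity)

lemma log_confFn_nonneg (A W k : ℕ) : 0 ≤ Real.log (confFn A W k) :=
  Real.log_nonneg (one_le_confFn A W k)

lemma log_confFn_mono (A W : ℕ) {j k : ℕ} (h : j ≤ k) :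
    Real.log (confFn A W j) ≤ Real.log (confFn A W k) := by
  refine Real.log_le_log (zero_lt_one.trans_le (one_le_confFn A W j)) ?_
  unfold confFn
  gcongr

end ConfFn

section Concentration

variable {A : ℕ} {Ω : Type*}

/-- The sum of the rewards of arm `i` over the rounds `1, …, k - 1`, each centred at `c`. For `c`
the mean of arm `i` this is the process whose deviations are controlled by a supermartingale. -/
noncomputable def centredSum (arm : ℕ → Ω → Fin A) (rew : ℕ → Ω → ℝ) (c : ℝ) (k : ℕ)
    (i : Fin A) (ω : Ω) : ℝ :=
  ∑ j ∈ (Finset.Ico 1 k).filter (fun j => arm j ω = i), (rew j ω - c)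

lemma centredSum_succ (arm : ℕ → Ω → Fin A) (rew : ℕ → Ω → ℝ) (c : ℝ) {k : ℕ} (hk : 1 ≤ k)
    (i : Fin A) (ω : Ω) :
    centredSum arm rew c (k + 1) i ω
      = centredSum arm rew c k i ω + if arm k ω = i then rew k ω - c else 0 := by
  simp only [centredSum, Finset.sum_filter]
  rw [Finset.sum_Ico_succ_top hk]

lemma centredSum_eq_mul (arm : ℕ → Ω → Fin A) (rew : ℕ → Ω → ℝ) (c : ℝ) {k : ℕ} {i : Fin A}
    {ω : Ω} (h : pullCount arm k i ω ≠ 0) :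
    centredSum arm rew c k i ω = pullCount arm k i ω * (empMean arm rew k i ω - c) := by
  have h0 : (pullCount arm k i ω : ℝ) ≠ 0 := Nat.cast_ne_zero.2 h
  rw [centredSum, Finset.sum_sub_distrib, Finset.sum_const, nsmul_eq_mul, empMean, mul_sub,
    mul_div_cancel₀ _ h0, pullCount]

/-- The exponential `exp (t S - t² N / 8)`, where `S` is the centred sum of the rewards of arm `i`
and `N` its number of pulls. Since `1 / 4` is the sub-Gaussian parameter of a `[0, 1]`-valued
variable, this is a supermartingale in `k` when `c` is the mean of arm `i`. -/
noncomputable def expCentredSum (arm : ℕ → Ω → Fin A) (rew : ℕ → Ω → ℝ) (c t : ℝ) (k : ℕ)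
    (i : Fin A) (ω : Ω) : ENNReal :=
  ENNReal.ofReal (Real.exp (t * centredSum arm rew c k i ω - t ^ 2 / 8 * pullCount arm k i ω))

lemma expCentredSum_succ_of_ne (arm : ℕ → Ω → Fin A) (rew : ℕ → Ω → ℝ) (c t : ℝ) {k : ℕ}
    (hk : 1 ≤ k) {i : Fin A} {ω : Ω} (h : arm k ω ≠ i) :
    expCentredSum arm rew c t (k + 1) i ω = expCentredSum arm rew c t k i ω := by
  simp only [expCentredSum, centredSum_succ _ _ _ hk, pullCount_succ _ hk, if_neg h, add_zero]

lemma expCentredSum_succ_of_eq (arm : ℕ → Ω → Fin A) (rew : ℕ → Ω → ℝ) (c t : ℝ) {k : ℕ}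
    (hk : 1 ≤ k) {i : Fin A} {ω : Ω} (h : arm k ω = i) :
    expCentredSum arm rew c t (k + 1) i ω = expCentredSum arm rew c t k i ω
      * ENNReal.ofReal (Real.exp (t * (rew k ω - c) - (1 / 4) * t ^ 2 / 2)) := by
  rw [expCentredSum, expCentredSum, ← ENNReal.ofReal_mul (Real.exp_nonneg _), ← Real.exp_add,
    centredSum_succ _ _ _ hk, pullCount_succ _ hk, if_pos h, if_pos h]
  push_cast
  ring_nf

lemma measurable_pullCount [MeasurableSpace Ω] {arm : ℕ → Ω → Fin A} {k : ℕ}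
    (h : ∀ j ∈ Finset.Ico 1 k, Measurable (arm j)) (i : Fin A) :
    Measurable fun ω => pullCount arm k i ω := by
  simp only [pullCount, Finset.card_filter]
  exact Finset.measurable_sum _ fun j hj =>
    Measurable.ite (h j hj (measurableSet_singleton i)) measurable_const measurable_const

lemma measurable_centredSum [MeasurableSpace Ω] {arm : ℕ → Ω → Fin A} {rew : ℕ → Ω → ℝ} {k : ℕ}
    (h : ∀ j ∈ Finset.Ico 1 k, Measurable (arm j))
    (h' : ∀ j ∈ Finset.Ico 1 k, Measurable (rew j)) (c : ℝ) (i : Fin A) :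
    Measurable fun ω => centredSum arm rew c k i ω := by
  simp only [centredSum, Finset.sum_filter]
  exact Finset.measurable_sum _ fun j hj =>
    Measurable.ite (h j hj (measurableSet_singleton i)) ((h' j hj).sub_const c) measurable_const

/-- In round `k`, along the sample path `ω`, the empirical mean of every arm pulled so far is
within its confidence width of the true mean. -/
def Accurate (α : ℝ) (W : ℕ) (M : BanditTask A) (arm : ℕ → Ω → Fin A) (rew : ℕ → Ω → ℝ) (k : ℕ)
    (ω : Ω) : Prop :=
  ∀ i, 1 ≤ pullCount arm k i ω → |empMean arm rew k i ω - M.mean i| ≤ confWidth α W arm k i ω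

/-- `arm` and `rew` record the arms and the rewards of a player of the task `M`, where `F k` is the
information on which the reward of round `k` is conditioned: it contains the arms up to round `k`
and the rewards before round `k`. -/
structure IsPlay {mΩ : MeasurableSpace Ω} (P : Measure Ω) (M : BanditTask A) (arm : ℕ → Ω → Fin A)
    (rew : ℕ → Ω → ℝ) (F : ℕ → MeasurableSpace Ω) : Prop where
  le : ∀ k, F k ≤ mΩ
  measurable_arm : ∀ j k, 1 ≤ j → j ≤ k → Measurable[F k] (arm j)
  measurable_rew_of_lt : ∀ j k, 1 ≤ j → j < k → Measurable[F k] (rew j)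
  measurable_rew : ∀ k, Measurable (rew k)
  law : ∀ k, 1 ≤ k → HasCondLaw P (F k) (rew k) fun ω => M.law (arm k ω)

namespace IsPlay

variable {M : BanditTask A} {arm : ℕ → Ω → Fin A} {rew : ℕ → Ω → ℝ} [mΩ : MeasurableSpace Ω]
  {P : Measure Ω} {F : ℕ → MeasurableSpace Ω}

lemma measurable_expCentredSum (h : IsPlay P M arm rew F) (t : ℝ) (i : Fin A) (k : ℕ) :
    Measurable[F k] (expCentredSum arm rew (M.mean i) t k i) := by
  have harm : ∀ j ∈ Finset.Ico 1 k, Measurable[F k] (arm j) := fun j hj =>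
    h.measurable_arm j k (Finset.mem_Ico.1 hj).1 (Finset.mem_Ico.1 hj).2.le
  have hrew : ∀ j ∈ Finset.Ico 1 k, Measurable[F k] (rew j) := fun j hj =>
    h.measurable_rew_of_lt j k (Finset.mem_Ico.1 hj).1 (Finset.mem_Ico.1 hj).2
  have hsum := @measurable_centredSum A Ω (F k) arm rew k harm hrew (M.mean i) i
  have hcount := @measurable_pullCount A Ω (F k) arm k harm i
  exact ENNReal.measurable_ofReal.comp (Real.measurable_exp.comp
    ((hsum.const_mul t).sub ((measurable_from_top.comp hcount).const_mul _)))

variable [IsProbabilityMeasure P]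

lemma setLIntegral_expCentredSum_succ_le (h : IsPlay P M arm rew F) (t : ℝ) (i : Fin A) {k : ℕ}
    (hk : 1 ≤ k) :
    ∫⁻ ω in arm k ⁻¹' {i}, expCentredSum arm rew (M.mean i) t (k + 1) i ω ∂P
      ≤ ∫⁻ ω in arm k ⁻¹' {i}, expCentredSum arm rew (M.mean i) t k i ω ∂P := by
  have hG : MeasurableSet[F k] (arm k ⁻¹' {i}) :=
    h.measurable_arm k k hk le_rfl (measurableSet_singleton i)
  have hlaw : ∀ ω ∈ arm k ⁻¹' {i}, M.law (arm k ω) = M.law i := fun ω hω => congrArg M.law hω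
  rw [setLIntegral_congr_fun (h.le k _ hG) fun ω hω => expCentredSum_succ_of_eq arm rew _ t hk hω,
    (h.law k hk).setLIntegral_mul_comp (h.le k) (h.measurable_rew k) hG hlaw
      (h.measurable_expCentredSum t i k) (g := fun x => ENNReal.ofReal (Real.exp
        (t * (x - M.mean i) - (1 / 4) * t ^ 2 / 2))) (by fun_prop)]
  exact mul_le_of_le_one_right'
    (by simpa using lintegral_exp_mul_sub_le_one (M.hasSubgaussianMGF_law i) t)

lemma lintegral_expCentredSum_le_one (h : IsPlay P M arm rew F) (t : ℝ) (i : Fin A) {k : ℕ}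
    (hk : 1 ≤ k) : ∫⁻ ω, expCentredSum arm rew (M.mean i) t k i ω ∂P ≤ 1 := by
  induction k, hk using Nat.le_induction with
  | base => simp [expCentredSum, centredSum, pullCount]
  | succ k hk ih =>
    refine le_trans ?_ ih
    have hG : MeasurableSet (arm k ⁻¹' {i}) :=
      h.le k _ (h.measurable_arm k k hk le_rfl (measurableSet_singleton i))
    rw [← lintegral_add_compl _ hG,
      ← lintegral_add_compl (expCentredSum arm rew (M.mean i) t k i) hG]
    refine add_le_add (h.setLIntegral_expCentredSum_succ_le t i hk) (le_of_eq ?_)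
    exact setLIntegral_congr_fun hG.compl fun ω hω => expCentredSum_succ_of_ne arm rew _ t hk hω

lemma measureReal_le_exp_neg (h : IsPlay P M arm rew F) (t x : ℝ) (i : Fin A) {k : ℕ}
    (hk : 1 ≤ k) :
    P.real {ω | x ≤ t * centredSum arm rew (M.mean i) k i ω - t ^ 2 / 8 * pullCount arm k i ω}
      ≤ Real.exp (-x) := by
  have hpos : ENNReal.ofReal (Real.exp x) ≠ 0 := by simp [Real.exp_pos]
  have hmeas : Measurable (expCentredSum arm rew (M.mean i) t k i) :=
    (h.measurable_expCentredSum t i k).mono (h.le k) le_rfl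
  refine ENNReal.toReal_le_of_le_ofReal (Real.exp_nonneg _) ?_
  calc P {ω | x ≤ t * centredSum arm rew (M.mean i) k i ω - t ^ 2 / 8 * pullCount arm k i ω}
      ≤ P {ω | ENNReal.ofReal (Real.exp x) ≤ expCentredSum arm rew (M.mean i) t k i ω} :=
        measure_mono fun ω hω => ENNReal.ofReal_le_ofReal (Real.exp_le_exp.2 hω)
    _ ≤ (∫⁻ ω, expCentredSum arm rew (M.mean i) t k i ω ∂P) / ENNReal.ofReal (Real.exp x) :=
        meas_ge_le_lintegral_div hmeas.aemeasurable hpos ENNReal.ofReal_ne_top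
    _ ≤ 1 / ENNReal.ofReal (Real.exp x) := by
        gcongr; exact h.lintegral_expCentredSum_le_one t i hk
    _ = ENNReal.ofReal (Real.exp (-x)) := by
        rw [Real.exp_neg, ENNReal.ofReal_inv_of_pos (Real.exp_pos _), one_div]

lemma measureReal_pullCount_eq_and_le_abs_centredSum_le (h : IsPlay P M arm rew F) {r : ℝ}
    (hr : 0 ≤ r) (n : ℕ) (i : Fin A) {k : ℕ} (hk : 1 ≤ k) :
    P.real {ω | pullCount arm k i ω = n ∧ n * r ≤ |centredSum arm rew (M.mean i) k i ω|}
      ≤ 2 * Real.exp (-(2 * n * r ^ 2)) := by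
  -- `t = ± 4 r` maximises `t * (n * r) - t ^ 2 / 8 * n`.
  have hsub : {ω | pullCount arm k i ω = n ∧ n * r ≤ |centredSum arm rew (M.mean i) k i ω|}
      ⊆ {ω | 2 * n * r ^ 2 ≤ (4 * r) * centredSum arm rew (M.mean i) k i ω
            - (4 * r) ^ 2 / 8 * pullCount arm k i ω}
        ∪ {ω | 2 * n * r ^ 2 ≤ (-(4 * r)) * centredSum arm rew (M.mean i) k i ω
            - (-(4 * r)) ^ 2 / 8 * pullCount arm k i ω} := by
    rintro ω ⟨hn, hdev⟩
    rw [Set.mem_union, Set.mem_ofPred_eq, Set.mem_ofPred_eq, hn]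
    rcases le_abs.1 hdev with hdev | hdev
    · left; nlinarith
    · right; nlinarith
  calc _ ≤ _ := measureReal_mono hsub
    _ ≤ _ := measureReal_union_le _ _
    _ ≤ _ := add_le_add (h.measureReal_le_exp_neg _ _ i hk) (h.measureReal_le_exp_neg _ _ i hk)
    _ = _ := (two_mul _).symm

lemma measureReal_not_accurate_le (h : IsPlay P M arm rew F) {α : ℝ} (hα : 0 ≤ α) (W : ℕ) {k : ℕ}
    (hk : 1 ≤ k) :
    P.real {ω | ¬ Accurate α W M arm rew k ω}
      ≤ 2 * A * k * Real.exp (-(4 * α * Real.log (confFn A W k))) := by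
  set L := Real.log (confFn A W k)
  set deviates : Fin A → ℕ → Set Ω := fun i n =>
    {ω | pullCount arm k i ω = n ∧
      n * √(2 * α * L / n) ≤ |centredSum arm rew (M.mean i) k i ω|}
  have hL : 0 ≤ L := log_confFn_nonneg A W k
  have hsub : {ω | ¬ Accurate α W M arm rew k ω}
      ⊆ ⋃ i ∈ (Finset.univ : Finset (Fin A)), ⋃ n ∈ Finset.Ico 1 k, deviates i n := by
    intro ω hω
    simp only [Set.mem_ofPred_eq, Accurate, not_forall, not_le] at hω
    obtain ⟨i, hi, hlt⟩ := hω
    have hle := pullCount_le arm k i ω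
    simp only [Set.mem_iUnion]
    refine ⟨i, Finset.mem_univ i, pullCount arm k i ω, Finset.mem_Ico.2 (by omega), rfl, ?_⟩
    rw [centredSum_eq_mul arm rew _ (by omega), abs_mul, Nat.abs_cast]
    exact mul_le_mul_of_nonneg_left hlt.le (Nat.cast_nonneg _)
  have hdev : ∀ i, ∀ n ∈ Finset.Ico 1 k, P.real (deviates i n) ≤ 2 * Real.exp (-(4 * α * L)) := by
    intro i n hn
    have hn0 : (0 : ℝ) < n := Nat.cast_pos.2 (Finset.mem_Ico.1 hn).1
    refine (h.measureReal_pullCount_eq_and_le_abs_centredSum_le (Real.sqrt_nonneg _)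
      n i hk).trans_eq ?_
    have hexp : 2 * n * (2 * α * L / n) = 4 * α * L := by field_simp; ring
    rw [Real.sq_sqrt (by positivity), hexp]
  calc P.real {ω | ¬ Accurate α W M arm rew k ω}
      ≤ ∑ i, ∑ n ∈ Finset.Ico 1 k, P.real (deviates i n) :=
        (measureReal_mono hsub (measure_ne_top _ _)).trans
          ((measureReal_biUnion_finset_le _ _).trans
          (Finset.sum_le_sum fun i _ => measureReal_biUnion_finset_le _ _))
    _ ≤ ∑ _i : Fin A, ∑ _n ∈ Finset.Ico 1 k, 2 * Real.exp (-(4 * α * L)) :=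
        Finset.sum_le_sum fun i _ => Finset.sum_le_sum fun n hn => hdev i n hn
    _ = 2 * A * ((k - 1 : ℕ) : ℝ) * Real.exp (-(4 * α * L)) := by
        simp only [Finset.sum_const, Nat.card_Ico, Finset.card_univ, Fintype.card_fin,
          nsmul_eq_mul]
        ring
    _ ≤ 2 * A * k * Real.exp (-(4 * α * L)) := by
        gcongr; exact Nat.sub_le k 1

end IsPlay

end Concentration

section ConfidenceBounds

variable {A W : ℕ} {Ω : Type*} {arm : ℕ → Ω → Fin A} {rew : ℕ → Ω → ℝ} {ω : Ω}
  {M : BanditTask A} {α : ℝ} {k : ℕ} {a b : Fin A}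

lemma confWidth_nonneg (arm : ℕ → Ω → Fin A) (k : ℕ) (a : Fin A) (ω : Ω) :
    0 ≤ confWidth α W arm k a ω := Real.sqrt_nonneg _

lemma confWidth_le_two_mul_confWidth (hα : 0 ≤ α) {arm' : ℕ → Ω → Fin A} {j : ℕ} (hjk : j ≤ k)
    (hb : 1 ≤ pullCount arm' k b ω) (hN : pullCount arm' k b ω ≤ 4 * pullCount arm j a ω) :
    confWidth α W arm j a ω ≤ 2 * confWidth α W arm' k b ω := by
  have hk := log_confFn_nonneg A W k
  have : (0 : ℝ) < pullCount arm' k b ω := Nat.cast_pos.2 hb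
  have hN' : (pullCount arm' k b ω : ℝ) ≤ 4 * pullCount arm j a ω := mod_cast hN
  calc confWidth α W arm j a ω
      ≤ √(2 * α * Real.log (confFn A W k) / (pullCount arm' k b ω / 4)) := by
        have hlog := log_confFn_mono A W hjk
        unfold confWidth
        gcongr
        linarith
    _ = √(2 ^ 2 * (2 * α * Real.log (confFn A W k) / pullCount arm' k b ω)) := by
        congr 1; field_simp; ring
    _ = 2 * confWidth α W arm' k b ω := by
        rw [Real.sqrt_mul (by norm_num), Real.sqrt_sq (by norm_num), confWidth]

namespace Accurate

lemma mean_le_ucb (h : Accurate α W M arm rew k ω) (ha : 1 ≤ pullCount arm k a ω) :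
    M.mean a ≤ ucb α W arm rew k a ω := by
  have := abs_le.1 (h a ha); rw [ucb]; linarith

lemma ucb_le (h : Accurate α W M arm rew k ω) (ha : 1 ≤ pullCount arm k a ω) :
    ucb α W arm rew k a ω ≤ M.mean a + 2 * confWidth α W arm k a ω := by
  have := abs_le.1 (h a ha); rw [ucb]; linarith

lemma lcb_le_mean (h : Accurate α W M arm rew k ω) (ha : 1 ≤ pullCount arm k a ω) :
    lcb α W arm rew k a ω ≤ M.mean a := by
  have := abs_le.1 (h a ha); rw [lcb]; linarith

lemma le_lcb (h : Accurate α W M arm rew k ω) (ha : 1 ≤ pullCount arm k a ω) :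
    M.mean a - 2 * confWidth α W arm k a ω ≤ lcb α W arm rew k a ω := by
  have := abs_le.1 (h a ha); rw [lcb]; linarith

lemma gap_le_of_forall_ucb_le (h : Accurate α W M arm rew k ω)
    (hN : ∀ i, 1 ≤ pullCount arm k i ω)
    (ha : ∀ i, ucb α W arm rew k i ω ≤ ucb α W arm rew k a ω) :
    M.gap a ≤ 2 * confWidth α W arm k a ω := by
  have : Nonempty (Fin A) := ⟨a⟩
  obtain ⟨i, hi⟩ := M.exists_isOptimal
  have hi_le := h.mean_le_ucb (hN i)
  have ha_le := h.ucb_le (hN a)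
  rw [BanditTask.gap, ← hi.mean_eq]
  linarith [ha i]

lemma gap_le_of_forall_lcb_le (h : Accurate α W M arm rew k ω)
    (hN : ∀ i, 1 ≤ pullCount arm k i ω) (hb : M.IsOptimal b)
    (ha : ∀ i, lcb α W arm rew k i ω ≤ lcb α W arm rew k a ω) :
    M.gap a ≤ 2 * confWidth α W arm k b ω := by
  have hle_b := h.le_lcb (hN b)
  have ha_le := h.lcb_le_mean (hN a)
  rw [BanditTask.gap, ← hb.mean_eq]
  linarith [ha b]

end Accurate

/-- The number `m` of pulls such that an arm whose gap is at most `40` times its confidence width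
in round `k` has been pulled at most `m / gap ^ 2` times: `3200 = 2 * 40 ^ 2`. -/
noncomputable def pullBudget (α : ℝ) (A W k : ℕ) : ℝ := 3200 * α * Real.log (confFn A W k)

lemma pullBudget_nonneg (hα : 0 ≤ α) (A W k : ℕ) : 0 ≤ pullBudget α A W k := by
  have := log_confFn_nonneg A W k
  unfold pullBudget
  positivity

lemma pullBudget_mono (hα : 0 ≤ α) (A W : ℕ) {j : ℕ} (h : j ≤ k) :
    pullBudget α A W j ≤ pullBudget α A W k :=
  mul_le_mul_of_nonneg_left (log_confFn_mono A W h) (by positivity)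

lemma pullCount_mul_sq_le_pullBudget (hα : 0 ≤ α) {g : ℝ} (hg : 0 ≤ g)
    (h : g ≤ 40 * confWidth α W arm k a ω) :
    pullCount arm k a ω * g ^ 2 ≤ pullBudget α A W k := by
  rcases (pullCount arm k a ω).eq_zero_or_pos with h0 | hpos
  · simpa [h0] using pullBudget_nonneg hα A W k
  have hL := log_confFn_nonneg A W k
  have : (0 : ℝ) < pullCount arm k a ω := Nat.cast_pos.2 hpos
  calc pullCount arm k a ω * g ^ 2 ≤ pullCount arm k a ω * (40 * confWidth α W arm k a ω) ^ 2 := by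
        gcongr
    _ = pullBudget α A W k := by
        rw [mul_pow, confWidth, Real.sq_sqrt (by positivity), pullBudget]
        field_simp
        ring

end ConfidenceBounds

/-- Along the sample path `ω`, the arms are chosen by the UCB rule after each arm has been tried
once. -/
structure FollowsUCB {A : ℕ} {Ω : Type*} (α : ℝ) (W : ℕ) (arm : ℕ → Ω → Fin A)
    (rew : ℕ → Ω → ℝ) (ω : Ω) : Prop where
  triesEveryArm : TriesEveryArm arm ω
  ucb_le : ∀ k, A < k → ∀ i, ucb α W arm rew k i ω ≤ ucb α W arm rew k (arm k ω) ω

/-- Round `k` is so late that, in the rounds up to `k`, less than an eighth of the pulls can go to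
arms with gap at least `D` that exceed neither their initial pull nor the pull budget. -/
def PastExploration (α D : ℝ) (A W k : ℕ) : Prop :=
  A * (pullBudget α A W k / D ^ 2 + 1) + 1 < (k : ℝ) / 8

section UCB

variable {A W : ℕ} {Ω : Type*} {arm : ℕ → Ω → Fin A} {rew : ℕ → Ω → ℝ} {ω : Ω}
  {M : BanditTask A} {α D : ℝ} {j k : ℕ} {a b : Fin A}

namespace PastExploration

lemma lt (h : PastExploration α D A W k) (hα : 0 ≤ α) (hk : k ≤ 8 * j) : A < j := by
  have hbudget := pullBudget_nonneg hα A W k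
  have hk' : (k : ℝ) ≤ 8 * j := mod_cast hk
  have hle : (A : ℝ) * 1 ≤ A * (pullBudget α A W k / D ^ 2 + 1) := by
    gcongr
    exact le_add_of_nonneg_left (by positivity)
  rw [PastExploration] at h
  have : (A : ℝ) < j := by linarith
  exact_mod_cast this

lemma pullBudget_lt (h : PastExploration α D A W k) (hα : 0 ≤ α) (hD : 0 < D) (hA : 1 ≤ A) :
    pullBudget α A W k < k / 8 * D ^ 2 := by
  have hbudget := pullBudget_nonneg hα A W k
  have hA' : (1 : ℝ) ≤ A := mod_cast hA
  have hle : 1 * (pullBudget α A W k / D ^ 2) ≤ A * (pullBudget α A W k / D ^ 2 + 1) := by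
    gcongr
    exact le_add_of_nonneg_right zero_le_one
  rw [PastExploration] at h
  rw [← div_lt_iff₀ (by positivity)]
  linarith

end PastExploration

namespace FollowsUCB

lemma gap_le_two_mul_confWidth (h : FollowsUCB α W arm rew ω) (hk : A < k)
    (hacc : Accurate α W M arm rew k ω) :
    M.gap (arm k ω) ≤ 2 * confWidth α W arm k (arm k ω) ω :=
  hacc.gap_le_of_forall_ucb_le (h.triesEveryArm.one_le_pullCount hk) (h.ucb_le k hk)

lemma pullCount_mul_sq_gap_le (h : FollowsUCB α W arm rew ω) (hα : 0 ≤ α) (hk : A < k)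
    (hacc : Accurate α W M arm rew k ω) :
    pullCount arm k (arm k ω) ω * M.gap (arm k ω) ^ 2 ≤ pullBudget α A W k := by
  have hgap := h.gap_le_two_mul_confWidth hk hacc
  have hw := confWidth_nonneg (α := α) (W := W) arm k (arm k ω) ω
  exact pullCount_mul_sq_le_pullBudget hα (M.gap_nonneg _) (by linarith)

-- The last pull of `a` happened when `a` already had a quarter of `k` pulls, and UCB only pulls an
-- arm whose gap is within its confidence width.
lemma gap_le_four_mul_confWidth (h : FollowsUCB α W arm rew ω) (hα : 0 ≤ α) (hk : A < k)
    (hacc : ∀ j, k ≤ 2 * j → j ≤ k → Accurate α W M arm rew j ω)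
    (ha : (k : ℝ) / 2 < pullCount arm k a ω) {arm' : ℕ → Ω → Fin A}
    (hb : 1 ≤ pullCount arm' k b ω) :
    M.gap a ≤ 4 * confWidth α W arm' k b ω := by
  have ha' : k < 2 * pullCount arm k a ω := by
    have : (k : ℝ) < 2 * pullCount arm k a ω := by linarith
    exact_mod_cast this
  have hA : 0 < A := Fin.pos a
  obtain ⟨j, hj1, hjk, rfl, hj⟩ := exists_last_pull (arm := arm) (k := k) (a := a) (ω := ω)
    (by omega)
  have hjN := pullCount_le arm j (arm j ω) ω
  have hkN := pullCount_le arm' k b ω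
  have hjA : A < j := by
    by_contra hcon
    have := h.triesEveryArm.pullCount_eq_zero hj1 (not_lt.1 hcon)
    omega
  calc M.gap (arm j ω) ≤ 2 * confWidth α W arm j (arm j ω) ω :=
        h.gap_le_two_mul_confWidth hjA (hacc j (by omega) hjk.le)
    _ ≤ 2 * (2 * confWidth α W arm' k b ω) := by
        gcongr
        exact confWidth_le_two_mul_confWidth hα hjk.le hb (by omega)
    _ = 4 * confWidth α W arm' k b ω := by ring

lemma card_ne_le (h : FollowsUCB α W arm rew ω) (hα : 0 ≤ α) (hD : 0 < D)
    (hgap : M.IsGapLowerBound D) (hb : ∀ a, M.IsOptimal a → a = b)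
    (hacc : ∀ t, k ≤ 8 * t → t ≤ k → Accurate α W M arm rew t ω)
    (hexp : PastExploration α D A W k) (hjk : j ≤ k) :
    (((Finset.Ico 1 j).filter fun t => ¬ arm t ω = b).card : ℝ)
      ≤ A * (pullBudget α A W k / D ^ 2 + 1) + k / 8 := by
  set S := (Finset.Ico 1 j).filter fun t => ¬ arm t ω = b
  have hlate : ((S.filter fun t => k ≤ 8 * t).card : ℝ)
      ≤ A * (pullBudget α A W k / D ^ 2 + 1) := by
    refine card_suboptimal_le (arm := arm) (ω := ω) hD hgap (pullBudget_nonneg hα A W k)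
      (fun t ht => ?_) fun t ht hopt => ?_
    · simp only [S, Finset.mem_filter, Finset.mem_Ico] at ht
      obtain ⟨⟨⟨ht1, htj⟩, -⟩, htk⟩ := ht
      have htk' : t ≤ k := htj.le.trans hjk
      exact ⟨ht1, (h.pullCount_mul_sq_gap_le hα (hexp.lt hα htk) (hacc t htk htk')).trans
        (pullBudget_mono hα A W htk')⟩
    · exact (Finset.mem_filter.1 (Finset.mem_filter.1 ht).1).2 (hb _ hopt)
  have hearly : ((S.filter fun t => ¬ k ≤ 8 * t).card : ℝ) ≤ k / 8 := by
    have hsub : S.filter (fun t => ¬ k ≤ 8 * t) ⊆ Finset.Icc 1 (k / 8) := fun t ht => by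
      simp only [S, Finset.mem_filter, Finset.mem_Ico] at ht
      rw [Finset.mem_Icc]
      omega
    have hcard := Finset.card_le_card hsub
    rw [Nat.card_Icc, Nat.add_sub_cancel] at hcard
    exact (Nat.cast_le.2 hcard).trans Nat.cast_div_le
  rw [← Finset.card_filter_add_card_filter_not (s := S) fun t => k ≤ 8 * t, Nat.cast_add]
  exact add_le_add hlate hearly

lemma half_lt_pullCount (h : FollowsUCB α W arm rew ω) (hα : 0 ≤ α) (hD : 0 < D)
    (hgap : M.IsGapLowerBound D) (hb : ∀ a, M.IsOptimal a → a = b)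
    (hacc : ∀ t, k ≤ 8 * t → t ≤ k → Accurate α W M arm rew t ω)
    (hexp : PastExploration α D A W k) (hj : k ≤ 2 * j) (hjk : j ≤ k) :
    (j : ℝ) / 2 < pullCount arm j b ω := by
  have hne := h.card_ne_le hα hD hgap hb hacc hexp hjk
  have hjA := hexp.lt (j := j) hα (by omega)
  have hsplit : pullCount arm j b ω + ((Finset.Ico 1 j).filter fun t => ¬ arm t ω = b).card + 1
      = j := by
    rw [pullCount, Finset.card_filter_add_card_filter_not, Nat.card_Ico]
    omega
  have hsplit' : (pullCount arm j b ω : ℝ)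
      + ((Finset.Ico 1 j).filter fun t => ¬ arm t ω = b).card + 1 = j := mod_cast hsplit
  have hj' : (k : ℝ) ≤ 2 * j := mod_cast hj
  rw [PastExploration] at hexp
  linarith

end FollowsUCB

lemma Accurate.isOptimal_of_forall_lcb_le (hacc : Accurate α W M arm rew j ω)
    (htry : TriesEveryArm arm ω) (hα : 0 ≤ α) (hD : 0 < D) (hgap : M.IsGapLowerBound D)
    (hexp : PastExploration α D A W k) (hj : k ≤ 2 * j) (hjk : j ≤ k) (hb : M.IsOptimal b)
    (hhalf : (j : ℝ) / 2 < pullCount arm j b ω)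
    (ha : ∀ i, lcb α W arm rew j i ω ≤ lcb α W arm rew j a ω) : M.IsOptimal a := by
  by_contra hna
  have hle := hacc.gap_le_of_forall_lcb_le
    (htry.one_le_pullCount (hexp.lt (j := j) hα (by omega))) hb ha
  have hw := confWidth_nonneg (α := α) (W := W) arm j b ω
  have hj' : (k : ℝ) ≤ 2 * j := mod_cast hj
  refine lt_irrefl (pullBudget α A W k) ?_
  calc pullBudget α A W k < k / 8 * D ^ 2 := hexp.pullBudget_lt hα hD (Fin.pos a)
    _ ≤ pullCount arm j b ω * D ^ 2 := by gcongr; linarith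
    _ ≤ pullCount arm j b ω * M.gap a ^ 2 := by gcongr; exact hgap a hna
    _ ≤ pullBudget α A W j :=
        pullCount_mul_sq_le_pullBudget hα (M.gap_nonneg a) (by linarith)
    _ ≤ pullBudget α A W k := pullBudget_mono hα A W hjk

end UCB

namespace TieredTrace

section TrustRun

variable {A W : ℕ} {Ω : Type*}

/-- In round `k` all confidence intervals of all tasks are correct. -/
def AllAccurate (T : TieredTrace A W Ω) (α : ℝ) (Hi : BanditTask A) (Lo : Fin W → BanditTask A)
    (k : ℕ) (ω : Ω) : Prop :=
  Accurate α W Hi T.armHi T.rewHi k ω ∧ ∀ w, Accurate α W (Lo w) (T.armLo w) (T.rewLo w) k ω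

/-- All confidence intervals of all tasks are correct in the rounds `k / r, …, k`. -/
def RecentlyAccurate (T : TieredTrace A W Ω) (α : ℝ) (Hi : BanditTask A)
    (Lo : Fin W → BanditTask A) (r k : ℕ) (ω : Ω) : Prop :=
  ∀ j, k ≤ r * j → j ≤ k → T.AllAccurate α Hi Lo j ω

variable {T : TieredTrace A W Ω} {α ε : ℝ}
  {Hi : BanditTask A} {Lo : Fin W → BanditTask A} {j k n : ℕ} {ω : Ω} {v w : Fin W}

lemma RecentlyAccurate.allAccurate {r : ℕ} (h : T.RecentlyAccurate α Hi Lo r k ω) (hr : 1 ≤ r) :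
    T.AllAccurate α Hi Lo k ω := h k (Nat.le_mul_of_pos_left k hr) le_rfl

lemma RecentlyAccurate.two_of_eight (h : T.RecentlyAccurate α Hi Lo 8 k ω) (hj : k ≤ 2 * j)
    (hjk : j ≤ k) : T.RecentlyAccurate α Hi Lo 2 j ω :=
  fun i hi hij => h i (by omega) (hij.trans hjk)

lemma lt_two_mul_pullCount_of_mem_passing (h : w ∈ T.passing α ε k ω) :
    k < 2 * pullCount (T.armLo w) k (T.lcbArm w k ω) ω := by
  have hhalf := (Finset.mem_filter.1 h).2.2
  rw [div_lt_iff₀ two_pos, mul_comm] at hhalf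
  exact_mod_cast hhalf

lemma lcbArm_succ_eq (hw : w ∈ T.passing α ε n ω) (hw' : w ∈ T.passing α ε (n + 1) ω) :
    T.lcbArm w (n + 1) ω = T.lcbArm w n ω := by
  have hmajority := lt_two_mul_pullCount_of_mem_passing hw
  have hmajority' := lt_two_mul_pullCount_of_mem_passing hw'
  have hmono := pullCount_mono (T.armLo w) n.le_succ (T.lcbArm w n ω) ω
  rw [Nat.succ_eq_add_one] at hmono
  exact eq_of_lt_pullCount_add_pullCount (arm := T.armLo w) (k := n + 1) (ω := ω) (by omega)

lemma Inherits.armHi_eq_lcbArm (h : T.Inherits α ε (n + 1) ω w) :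
    T.armHi n ω = T.lcbArm w (n + 1) ω := by
  have hmajority := lt_two_mul_pullCount_of_mem_passing h.1
  have hmax := h.2 (T.lcbArm w (n + 1) ω)
  rw [Nat.add_sub_cancel] at hmax
  exact eq_of_lt_pullCount_add_pullCount (arm := T.armLo w) (k := n + 1) (ω := ω) (by omega)

lemma inherits_of_lcbArm_eq (hv : v ∈ T.passing α ε (n + 1) ω)
    (harm : T.lcbArm v (n + 1) ω = T.armHi n ω) : T.Inherits α ε (n + 1) ω v := by
  refine ⟨hv, fun i => ?_⟩
  have hmajority := lt_two_mul_pullCount_of_mem_passing hv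
  rw [Nat.add_sub_cancel, ← harm]
  by_contra! hlt
  have := eq_of_lt_pullCount_add_pullCount (arm := T.armLo v) (k := n + 1) (ω := ω)
    (a := T.lcbArm v (n + 1) ω) (b := i) (by omega)
  exact hlt.ne (by rw [this])

namespace IsTrustRun

variable [MeasurableSpace Ω] {P : Measure Ω} {D : ℝ} {b : Fin A}

lemma followsUCB_armLo (h : T.IsTrustRun P α ε Hi Lo) (w : Fin W) (ω : Ω) :
    FollowsUCB α W (T.armLo w) (T.rewLo w) ω :=
  ⟨h.init_armLo w ω, fun k hk => h.armLo_ucb w k hk ω⟩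

lemma one_le_pullCount_armHi (h : T.IsTrustRun P α ε Hi Lo) (hk : A < k) (i : Fin A) :
    1 ≤ pullCount T.armHi k i ω := TriesEveryArm.one_le_pullCount (h.init_armHi ω) hk i

lemma one_le_pullCount_armLo (h : T.IsTrustRun P α ε Hi Lo) (hk : A < k) (w : Fin W) (i : Fin A) :
    1 ≤ pullCount (T.armLo w) k i ω := TriesEveryArm.one_le_pullCount (h.init_armLo w ω) hk i

lemma exists_task_eq_some (h : T.IsTrustRun P α ε Hi Lo) (hk : A < k)
    (hne : (T.passing α ε k ω).Nonempty) : ∃ w ∈ T.passing α ε k ω, T.task k ω = some w := by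
  by_cases hkeep : T.CanKeep α ε k ω
  · obtain ⟨w, hw, hprev⟩ := id hkeep
    exact ⟨w, hw, (h.task_keep k hk ω hkeep).trans hprev⟩
  by_cases hinherit : T.task (k - 1) ω ≠ none ∧ ∃ w, T.Inherits α ε k ω w
  · obtain ⟨w, hw, htask⟩ := h.task_inherit k hk ω hkeep hinherit.1 hinherit.2
    exact ⟨w, hw.1, htask⟩
  · exact h.task_resample k hk ω ⟨hne, hkeep, hinherit⟩

lemma mem_passing (h : T.IsTrustRun P α ε Hi Lo) (hk : A < k) (hw : T.task k ω = some w) :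
    w ∈ T.passing α ε k ω := by
  rcases (T.passing α ε k ω).eq_empty_or_nonempty with hempty | hne
  · exact absurd (hw.symm.trans (h.task_none k hk ω hempty)) (Option.some_ne_none w)
  · obtain ⟨v, hv, htask⟩ := h.exists_task_eq_some hk hne
    exact Option.some_injective _ (hw.symm.trans htask) ▸ hv

section Exploration

lemma gap_armHi_le_of_task_eq_some (h : T.IsTrustRun P α ε Hi Lo) (hα : 0 ≤ α)
    (hdom : BanditTask.OptValueDominance D Hi Lo) (hε : ε ≤ D / 4) (hk : A < k)
    (hacc : T.RecentlyAccurate α Hi Lo 2 k ω) (hw : T.task k ω = some w) :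
    Hi.gap (T.armHi k ω) ≤ 40 * confWidth α W T.armHi k (T.armHi k ω) ω := by
  by_cases hopt : Hi.IsOptimal (T.armHi k ω)
  · rw [hopt.gap_eq_zero]
    exact mul_nonneg (by norm_num) (confWidth_nonneg _ _ _ _)
  have hpass := h.mem_passing hk hw
  have hmajority := lt_two_mul_pullCount_of_mem_passing hpass
  obtain ⟨hlcb_le, hhalf⟩ := (Finset.mem_filter.1 hpass).2
  rw [← h.armHi_trust k hk ω w hw] at hmajority hlcb_le hhalf
  set a := T.armHi k ω
  have hNHi : 1 ≤ pullCount T.armHi k a ω := h.one_le_pullCount_armHi hk a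
  have hNle := pullCount_le T.armHi k a ω
  have hgapLo : (Lo w).gap a ≤ 4 * confWidth α W T.armHi k a ω :=
    (h.followsUCB_armLo w ω).gap_le_four_mul_confWidth hα hk
      (fun j hj hjk => (hacc j hj hjk).2 w) hhalf hNHi
  have hwidth : confWidth α W (T.armLo w) k a ω ≤ 2 * confWidth α W T.armHi k a ω :=
    confWidth_le_two_mul_confWidth hα le_rfl hNHi (by omega)
  have hucb := (hacc.allAccurate one_le_two).1.ucb_le hNHi
  have hlcb := ((hacc.allAccurate one_le_two).2 w).le_lcb (h.one_le_pullCount_armLo hk w a)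
  have hvalue := hdom.sub_le_optValue w
  have hD := hdom.isGapLowerBound a hopt
  rw [BanditTask.gap] at hgapLo hD ⊢
  linarith

lemma pullCount_mul_sq_gap_armHi_le (h : T.IsTrustRun P α ε Hi Lo) (hα : 0 ≤ α)
    (hdom : BanditTask.OptValueDominance D Hi Lo) (hε : ε ≤ D / 4) (hk : A < k)
    (hacc : T.RecentlyAccurate α Hi Lo 2 k ω) :
    pullCount T.armHi k (T.armHi k ω) ω * Hi.gap (T.armHi k ω) ^ 2 ≤ pullBudget α A W k := by
  refine pullCount_mul_sq_le_pullBudget hα (Hi.gap_nonneg _) ?_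
  cases htask : T.task k ω with
  | some w => exact h.gap_armHi_le_of_task_eq_some hα hdom hε hk hacc htask
  | none =>
    have hgap := (hacc.allAccurate one_le_two).1.gap_le_of_forall_ucb_le
      (h.one_le_pullCount_armHi hk) (h.armHi_ucb k hk ω htask)
    linarith [confWidth_nonneg (α := α) (W := W) T.armHi k (T.armHi k ω) ω]

end Exploration

section LockIn

lemma armHi_succ_eq (h : T.IsTrustRun P α ε Hi Lo) (hn : A < n) (htask : T.task n ω ≠ none)
    (hv : v ∈ T.passing α ε (n + 1) ω) (harm : T.lcbArm v (n + 1) ω = T.armHi n ω) :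
    T.armHi (n + 1) ω = T.armHi n ω := by
  have hn' : A < n + 1 := hn.trans n.lt_succ_self
  by_cases hkeep : T.CanKeep α ε (n + 1) ω
  · obtain ⟨w, hw, hprev⟩ := id hkeep
    have hnext := (h.task_keep (n + 1) hn' ω hkeep).trans hprev
    rw [Nat.add_sub_cancel] at hprev
    rw [h.armHi_trust n hn ω w hprev, h.armHi_trust (n + 1) hn' ω w hnext,
      lcbArm_succ_eq (h.mem_passing hn hprev) hw]
  · obtain ⟨w, hw, hnext⟩ := h.task_inherit (n + 1) hn' ω hkeep htask
      ⟨v, inherits_of_lcbArm_eq hv harm⟩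
    rw [h.armHi_trust (n + 1) hn' ω w hnext, hw.armHi_eq_lcbArm]

lemma mem_passing_and_lcbArm_eq_of_isClose (h : T.IsTrustRun P α ε Hi Lo) (hα : 0 ≤ α)
    (hD : 0 < D) (hb : Hi.IsOptimal b) (hbu : ∀ a, Hi.IsOptimal a → a = b)
    (hclose : BanditTask.IsClose ε Hi (Lo w)) (hgap : (Lo w).IsGapLowerBound D)
    (hacc : T.RecentlyAccurate α Hi Lo 8 k ω) (hexp : PastExploration α D A W k)
    (hj : k ≤ 2 * j) (hjk : j ≤ k) :
    w ∈ T.passing α ε j ω ∧ T.lcbArm w j ω = b := by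
  have hAj : A < j := hexp.lt hα (by omega)
  have haccj : T.AllAccurate α Hi Lo j ω := hacc j (by omega) hjk
  have hbLo : (Lo w).IsOptimal b := (hclose.2 b).1 hb
  have hbuLo : ∀ a, (Lo w).IsOptimal a → a = b := fun a ha => hbu a ((hclose.2 a).2 ha)
  have hhalf : (j : ℝ) / 2 < pullCount (T.armLo w) j b ω :=
    (h.followsUCB_armLo w ω).half_lt_pullCount hα hD hgap hbuLo
      (fun t ht htk => (hacc t ht htk).2 w) hexp hj hjk
  have hlcb : T.lcbArm w j ω = b := hbuLo _ <|
    (haccj.2 w).isOptimal_of_forall_lcb_le (h.init_armLo w ω) hα hD hgap hexp hj hjk hbLo hhalf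
      (h.lcbArm_lcb w j hAj ω)
  refine ⟨Finset.mem_filter.2 ⟨Finset.mem_univ w, ?_⟩, hlcb⟩
  rw [hlcb]
  have hlcb_le := (haccj.2 w).lcb_le_mean (h.one_le_pullCount_armLo hAj w b)
  have hle_ucb := haccj.1.mean_le_ucb (h.one_le_pullCount_armHi hAj b)
  have hvalue := hclose.1
  rw [hbLo.mean_eq] at hlcb_le
  rw [hb.mean_eq] at hle_ucb
  exact ⟨by linarith, hhalf⟩

lemma exists_isOptimal_armHi (h : T.IsTrustRun P α ε Hi Lo) (hα : 0 ≤ α) (hD : 0 < D)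
    (hdom : BanditTask.OptValueDominance D Hi Lo) (hε : ε ≤ D / 4)
    (hacc : T.RecentlyAccurate α Hi Lo 8 k ω) (hexp : PastExploration α D A W k) :
    ∃ j, k ≤ 2 * j ∧ j ≤ k ∧ Hi.IsOptimal (T.armHi j ω) := by
  by_contra! hcon
  have hlate : ∀ j ∈ Finset.Icc ((k + 1) / 2) k, k ≤ 2 * j ∧ j ≤ k := fun j hj => by
    rw [Finset.mem_Icc] at hj; omega
  have hcard := card_suboptimal_le (arm := T.armHi) (ω := ω) (S := Finset.Icc ((k + 1) / 2) k)
    hD hdom.isGapLowerBound (pullBudget_nonneg hα A W k)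
    (fun j hj => by
      obtain ⟨hj, hjk⟩ := hlate j hj
      have hAj : A < j := hexp.lt hα (by omega)
      exact ⟨by omega, (h.pullCount_mul_sq_gap_armHi_le hα hdom hε hAj
        (hacc.two_of_eight hj hjk)).trans (pullBudget_mono hα A W hjk)⟩)
    (fun j hj => hcon j (hlate j hj).1 (hlate j hj).2)
  have hhalf : k ≤ 2 * (Finset.Icc ((k + 1) / 2) k).card := by rw [Nat.card_Icc]; omega
  have hhalf' : (k : ℝ) ≤ 2 * (Finset.Icc ((k + 1) / 2) k).card := mod_cast hhalf
  rw [PastExploration] at hexp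
  linarith

lemma isOptimal_armHi (h : T.IsTrustRun P α ε Hi Lo) (hα : 0 ≤ α) (hD : 0 < D)
    (hdom : BanditTask.OptValueDominance D Hi Lo) (hε : ε ≤ D / 4) (hHi : ∃! i, Hi.IsOptimal i)
    (hclose : BanditTask.IsClose ε Hi (Lo w)) (hgap : (Lo w).IsGapLowerBound D)
    (hacc : T.RecentlyAccurate α Hi Lo 8 k ω) (hexp : PastExploration α D A W k) :
    Hi.IsOptimal (T.armHi k ω) := by
  obtain ⟨b, hb, hbu⟩ := hHi
  obtain ⟨j, hj, hjk, hopt⟩ := h.exists_isOptimal_armHi hα hD hdom hε hacc hexp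
  have hpass : ∀ n, j ≤ n → n ≤ k → w ∈ T.passing α ε n ω ∧ T.lcbArm w n ω = b := fun n hjn hnk =>
    h.mem_passing_and_lcbArm_eq_of_isClose hα hD hb hbu hclose hgap hacc hexp (by omega) hnk
  have hlocked : ∀ n, j ≤ n → n ≤ k → T.armHi n ω = b := by
    intro n hjn
    induction n, hjn using Nat.le_induction with
    | base => exact fun _ => hbu _ hopt
    | succ n hjn ih =>
      intro hnk
      have hn : T.armHi n ω = b := ih (by omega)
      have hAn : A < n := hexp.lt hα (by omega)
      obtain ⟨v, -, hv⟩ := h.exists_task_eq_some hAn ⟨w, (hpass n hjn (by omega)).1⟩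
      obtain ⟨hw, hlcb⟩ := hpass (n + 1) (by omega) hnk
      exact (h.armHi_succ_eq hAn (hv ▸ Option.some_ne_none v) hw (hlcb.trans hn.symm)).trans hn
  rw [hlocked k hjk le_rfl]
  exact hb

end LockIn

end IsTrustRun

end TrustRun

end TieredTrace

section Expectation

variable {Ω : Type*} [MeasurableSpace Ω]

lemma integral_sum_le_add_sum_measureReal {ι : Type*} {P : Measure Ω} [IsProbabilityMeasure P]
    {s : Finset ι} {X : ι → Ω → ℝ} {bad : ι → Set Ω} {c : ℝ}
    (hX : ∀ k ω, X k ω ∈ Set.Icc (0 : ℝ) 1)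
    (hgood : ∀ ω, ∀ t ⊆ s, (∀ k ∈ t, ω ∉ bad k) → ∑ k ∈ t, X k ω ≤ c) :
    ∫ ω, ∑ k ∈ s, X k ω ∂P ≤ c + ∑ k ∈ s, P.real (bad k) := by
  classical
  -- The events `bad k` need not be measurable.
  set B : ι → Set Ω := fun k => toMeasurable P (bad k)
  have hB : ∀ k, MeasurableSet (B k) := fun k => measurableSet_toMeasurable _ _
  have hint : ∀ k ∈ s, Integrable ((B k).indicator fun _ => (1 : ℝ)) P := fun k _ =>
    (integrable_const 1).indicator (hB k)
  have hpoint : ∀ ω, ∑ k ∈ s, X k ω ≤ c + ∑ k ∈ s, (B k).indicator (fun _ => (1 : ℝ)) ω := by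
    intro ω
    calc ∑ k ∈ s, X k ω
        ≤ ∑ k ∈ s, ((if ω ∉ bad k then X k ω else 0) + (B k).indicator (fun _ => (1 : ℝ)) ω) := by
          refine Finset.sum_le_sum fun k _ => ?_
          by_cases hk : ω ∈ bad k
          · rw [if_neg (not_not.2 hk), zero_add,
              Set.indicator_of_mem (subset_toMeasurable P _ hk)]
            exact (hX k ω).2
          · rw [if_pos hk]
            exact le_add_of_nonneg_right (Set.indicator_nonneg (fun _ _ => zero_le_one) ω)
      _ ≤ c + ∑ k ∈ s, (B k).indicator (fun _ => (1 : ℝ)) ω := by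
          rw [Finset.sum_add_distrib, ← Finset.sum_filter]
          gcongr
          exact hgood ω _ (Finset.filter_subset _ s) fun k hk => (Finset.mem_filter.1 hk).2
  calc ∫ ω, ∑ k ∈ s, X k ω ∂P
      ≤ ∫ ω, (c + ∑ k ∈ s, (B k).indicator (fun _ => (1 : ℝ)) ω) ∂P :=
        integral_mono_of_nonneg (ae_of_all _ fun ω => Finset.sum_nonneg fun k _ => (hX k ω).1)
          ((integrable_const c).add (integrable_finsetSum s hint)) (ae_of_all _ hpoint)
    _ = c + ∑ k ∈ s, P.real (bad k) := by
        rw [integral_add (integrable_const c) (integrable_finsetSum s hint),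
          integral_finsetSum s hint, integral_const, probReal_univ, one_smul]
        congr 1
        refine Finset.sum_congr rfl fun k _ => ?_
        rw [integral_indicator_const _ (hB k), smul_eq_mul, mul_one, measureReal_def,
          measure_toMeasurable, measureReal_def]

end Expectation

lemma sum_inv_sq_le_two (K : ℕ) : ∑ k ∈ Finset.Icc 1 K, 1 / (k : ℝ) ^ 2 ≤ 2 := by
  calc ∑ k ∈ Finset.Icc 1 K, 1 / (k : ℝ) ^ 2
      = ∑ k ∈ Finset.Ioo 0 (K + 1), ((k : ℝ) ^ 2)⁻¹ := by simp only [one_div]; rfl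
    _ ≤ 2 := (sum_Ioo_inv_sq_le 0 (K + 1)).trans_eq (by norm_num)

namespace TieredTrace

section Probability

variable {A W : ℕ} {Ω : Type*}

section Information

variable (T : TieredTrace A W Ω) {j k : ℕ}

lemma info_le_history (hj : 1 ≤ j) (hjk : j < k) :
    T.decisionInfo j ⊔ T.rewardInfo j ≤ T.history k :=
  le_iSup₂ (f := fun j (_ : j ∈ Finset.Ico 1 k) => T.decisionInfo j ⊔ T.rewardInfo j) j
    (Finset.mem_Ico.2 ⟨hj, hjk⟩)

lemma decisionInfo_le_history_sup (hj : 1 ≤ j) (hjk : j ≤ k) :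
    T.decisionInfo j ≤ T.history k ⊔ T.decisionInfo k := by
  rcases hjk.eq_or_lt with rfl | hlt
  · exact le_sup_right
  · exact (le_sup_left.trans (T.info_le_history hj hlt)).trans le_sup_left

lemma rewardInfo_le_history_sup (hj : 1 ≤ j) (hjk : j < k) :
    T.rewardInfo j ≤ T.history k ⊔ T.decisionInfo k :=
  (le_sup_right.trans (T.info_le_history hj hjk)).trans le_sup_left

lemma measurable_armHi_decisionInfo (k : ℕ) : Measurable[T.decisionInfo k] (T.armHi k) :=
  Measurable.of_comap_le le_sup_right

lemma measurable_armLo_decisionInfo (w : Fin W) (k : ℕ) :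
    Measurable[T.decisionInfo k] (T.armLo w k) :=
  Measurable.of_comap_le <| (le_iSup (fun w => MeasurableSpace.comap (T.armLo w k) ⊤) w).trans <|
    le_sup_left.trans (le_sup_left.trans le_sup_left)

lemma measurable_rewHi_rewardInfo (k : ℕ) : Measurable[T.rewardInfo k] (T.rewHi k) :=
  Measurable.of_comap_le le_sup_right

lemma measurable_rewLo_rewardInfo (w : Fin W) (k : ℕ) :
    Measurable[T.rewardInfo k] (T.rewLo w k) :=
  Measurable.of_comap_le <|
    (le_iSup (fun w => MeasurableSpace.comap (T.rewLo w k) inferInstance) w).trans le_sup_left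

end Information

variable [mΩ : MeasurableSpace Ω] {P : Measure Ω} {T : TieredTrace A W Ω} {α ε D : ℝ}
  {Hi : BanditTask A} {Lo : Fin W → BanditTask A} {k : ℕ}

namespace IsTrustRun

lemma decisionInfo_le (h : T.IsTrustRun P α ε Hi Lo) (k : ℕ) : T.decisionInfo k ≤ mΩ :=
  sup_le (sup_le (sup_le (iSup_le fun w => (h.measurable_armLo w k).comap_le)
    (iSup_le fun w => (h.measurable_lcbArm w k).comap_le)) (h.measurable_task k).comap_le)
    (h.measurable_armHi k).comap_le

lemma rewardInfo_le (h : T.IsTrustRun P α ε Hi Lo) (k : ℕ) : T.rewardInfo k ≤ mΩ :=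
  sup_le (iSup_le fun w => (h.measurable_rewLo w k).comap_le) (h.measurable_rewHi k).comap_le

lemma history_sup_decisionInfo_le (h : T.IsTrustRun P α ε Hi Lo) (k : ℕ) :
    T.history k ⊔ T.decisionInfo k ≤ mΩ :=
  sup_le (iSup₂_le fun j _ => sup_le (h.decisionInfo_le j) (h.rewardInfo_le j))
    (h.decisionInfo_le k)

lemma isPlay_armHi (h : T.IsTrustRun P α ε Hi Lo) :
    IsPlay P Hi T.armHi T.rewHi fun k => T.history k ⊔ T.decisionInfo k where
  le := h.history_sup_decisionInfo_le
  measurable_arm j _ hj hjk :=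
    (T.measurable_armHi_decisionInfo j).mono (T.decisionInfo_le_history_sup hj hjk) le_rfl
  measurable_rew_of_lt j _ hj hjk :=
    (T.measurable_rewHi_rewardInfo j).mono (T.rewardInfo_le_history_sup hj hjk) le_rfl
  measurable_rew := h.measurable_rewHi
  law := h.law_rewHi

lemma isPlay_armLo (h : T.IsTrustRun P α ε Hi Lo) (w : Fin W) :
    IsPlay P (Lo w) (T.armLo w) (T.rewLo w) fun k => T.history k ⊔ T.decisionInfo k where
  le := h.history_sup_decisionInfo_le
  measurable_arm j _ hj hjk :=
    (T.measurable_armLo_decisionInfo w j).mono (T.decisionInfo_le_history_sup hj hjk) le_rfl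
  measurable_rew_of_lt j _ hj hjk :=
    (T.measurable_rewLo_rewardInfo w j).mono (T.rewardInfo_le_history_sup hj hjk) le_rfl
  measurable_rew := h.measurable_rewLo w
  law := h.law_rewLo w

variable [IsProbabilityMeasure P]

lemma measureReal_not_allAccurate_le (h : T.IsTrustRun P α ε Hi Lo) (hα : 0 ≤ α) (hk : 1 ≤ k) :
    P.real {ω | ¬ T.AllAccurate α Hi Lo k ω}
      ≤ (1 + W) * (2 * A * k * Real.exp (-(4 * α * Real.log (confFn A W k)))) := by
  set q := 2 * A * k * Real.exp (-(4 * α * Real.log (confFn A W k)))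
  have hsub : {ω | ¬ T.AllAccurate α Hi Lo k ω} ⊆ {ω | ¬ Accurate α W Hi T.armHi T.rewHi k ω}
      ∪ ⋃ w ∈ (Finset.univ : Finset (Fin W)),
        {ω | ¬ Accurate α W (Lo w) (T.armLo w) (T.rewLo w) k ω} := by
    intro ω hω
    simp only [Set.mem_union, Set.mem_iUnion, Set.mem_ofPred_eq, Finset.mem_univ, exists_prop,
      true_and, ← not_forall, ← not_and_or]
    exact hω
  calc P.real {ω | ¬ T.AllAccurate α Hi Lo k ω}
      ≤ P.real {ω | ¬ Accurate α W Hi T.armHi T.rewHi k ω} + ∑ w,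
        P.real {ω | ¬ Accurate α W (Lo w) (T.armLo w) (T.rewLo w) k ω} :=
        (measureReal_mono hsub).trans ((measureReal_union_le _ _).trans
          (add_le_add_right (measureReal_biUnion_finset_le _ _) _))
    _ ≤ q + ∑ _w : Fin W, q := add_le_add (h.isPlay_armHi.measureReal_not_accurate_le hα W hk)
        (Finset.sum_le_sum fun w _ => (h.isPlay_armLo w).measureReal_not_accurate_le hα W hk)
    _ = (1 + W) * q := by
        rw [Finset.sum_const, Finset.card_univ, Fintype.card_fin, nsmul_eq_mul, one_add_mul]

end IsTrustRun

lemma exp_neg_four_mul_log_confFn_le (hα : 1 / 2 ≤ α) (A W k : ℕ) (hA : 1 ≤ A) (hW : 1 ≤ W)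
    (hk : 1 ≤ k) :
    Real.exp (-(4 * α * Real.log (confFn A W k))) ≤ ((16 * W * A ^ 2 * k ^ 2 : ℝ) ^ 2)⁻¹ := by
  have : (0 : ℝ) < A := Nat.cast_pos.2 hA
  have : (0 : ℝ) < W := Nat.cast_pos.2 hW
  have : (0 : ℝ) < k := Nat.cast_pos.2 hk
  have hlog := log_confFn_nonneg A W k
  have hpos : 0 < confFn A W k := zero_lt_one.trans_le (one_le_confFn A W k)
  have hconf : 16 * W * (A : ℝ) ^ 2 * k ^ 2 ≤ confFn A W k := by
    unfold confFn
    refine le_add_of_nonneg_of_le zero_le_one ?_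
    gcongr
    exact le_add_of_nonneg_right zero_le_one
  calc Real.exp (-(4 * α * Real.log (confFn A W k)))
      ≤ Real.exp (-(Real.log (confFn A W k ^ 2))) := by
        rw [Real.log_pow]
        gcongr
        push_cast
        linarith
    _ = (confFn A W k ^ 2)⁻¹ := by rw [Real.exp_neg, Real.exp_log (by positivity)]
    _ ≤ ((16 * W * A ^ 2 * k ^ 2 : ℝ) ^ 2)⁻¹ := by gcongr

namespace IsTrustRun

variable [IsProbabilityMeasure P]

lemma measureReal_not_allAccurate_le_inv_cube (h : T.IsTrustRun P α ε Hi Lo) (hα : 1 / 2 ≤ α)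
    (hA : 1 ≤ A) (hW : 1 ≤ W) (hk : 1 ≤ k) :
    P.real {ω | ¬ T.AllAccurate α Hi Lo k ω} ≤ 1 / (64 * (k : ℝ) ^ 3) := by
  have hA' : (1 : ℝ) ≤ A := mod_cast hA
  have hW' : (1 : ℝ) ≤ W := mod_cast hW
  have : (0 : ℝ) < k := Nat.cast_pos.2 hk
  calc P.real {ω | ¬ T.AllAccurate α Hi Lo k ω}
      ≤ (1 + W) * (2 * A * k * Real.exp (-(4 * α * Real.log (confFn A W k)))) :=
        h.measureReal_not_allAccurate_le (by linarith) hk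
    _ ≤ (W + W) * (2 * A * k * ((16 * W * A ^ 2 * k ^ 2 : ℝ) ^ 2)⁻¹) := by
        gcongr
        exact exp_neg_four_mul_log_confFn_le hα A W k hA hW hk
    _ = 1 / (64 * (k : ℝ) ^ 3) * (1 / (W * A ^ 3)) := by field_simp; ring
    _ ≤ 1 / (64 * (k : ℝ) ^ 3) := by
        refine mul_le_of_le_one_right (by positivity) ((div_le_one (by positivity)).2 ?_)
        exact one_le_mul_of_one_le_of_one_le hW' (one_le_pow₀ hA')

lemma measureReal_not_recentlyAccurate_le (h : T.IsTrustRun P α ε Hi Lo) (hα : 1 / 2 ≤ α)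
    (hA : 1 ≤ A) (hW : 1 ≤ W) (hk : 1 ≤ k) :
    P.real {ω | ¬ T.RecentlyAccurate α Hi Lo 8 k ω} ≤ 8 * (1 / (k : ℝ) ^ 2) := by
  have : (0 : ℝ) < k := Nat.cast_pos.2 hk
  set s := (Finset.Icc 1 k).filter fun j => k ≤ 8 * j
  have hsub : {ω | ¬ T.RecentlyAccurate α Hi Lo 8 k ω}
      ⊆ ⋃ j ∈ s, {ω | ¬ T.AllAccurate α Hi Lo j ω} := by
    intro ω hω
    simp only [Set.mem_ofPred_eq, RecentlyAccurate, not_forall] at hω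
    obtain ⟨j, hj, hjk, hbad⟩ := hω
    simp only [Set.mem_iUnion]
    exact ⟨j, Finset.mem_filter.2 ⟨Finset.mem_Icc.2 ⟨by omega, hjk⟩, hj⟩, hbad⟩
  have hbad : ∀ j ∈ s, P.real {ω | ¬ T.AllAccurate α Hi Lo j ω} ≤ 8 / (k : ℝ) ^ 3 := by
    intro j hj
    obtain ⟨hj1, hj⟩ := Finset.mem_filter.1 hj
    have hj' : (k : ℝ) ≤ 8 * j := mod_cast hj
    calc P.real {ω | ¬ T.AllAccurate α Hi Lo j ω} ≤ 1 / (64 * (j : ℝ) ^ 3) :=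
          h.measureReal_not_allAccurate_le_inv_cube hα hA hW (Finset.mem_Icc.1 hj1).1
      _ ≤ 1 / (64 * ((k : ℝ) / 8) ^ 3) := by gcongr; linarith
      _ = 8 / (k : ℝ) ^ 3 := by field_simp; norm_num
  calc P.real {ω | ¬ T.RecentlyAccurate α Hi Lo 8 k ω}
      ≤ ∑ j ∈ s, P.real {ω | ¬ T.AllAccurate α Hi Lo j ω} :=
        (measureReal_mono hsub (measure_ne_top _ _)).trans
          (measureReal_biUnion_finset_le _ _)
    _ ≤ s.card * (8 / (k : ℝ) ^ 3) := by
        rw [← nsmul_eq_mul]; exact Finset.sum_le_card_nsmul _ _ _ hbad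
    _ ≤ k * (8 / (k : ℝ) ^ 3) := by
        gcongr
        exact (Finset.card_filter_le _ _).trans_eq (by rw [Nat.card_Icc, Nat.add_sub_cancel])
    _ = 8 * (1 / (k : ℝ) ^ 2) := by field_simp

lemma regretHi_le (h : T.IsTrustRun P α ε Hi Lo) (hα : 1 / 2 ≤ α) (hW : 1 ≤ W)
    (hdom : BanditTask.OptValueDominance D Hi Lo) (hε : ε ≤ D / 4)
    (hsub : ∃ i, ¬ Hi.IsOptimal i) {K : ℕ} {m : ℝ} (hm : 0 ≤ m)
    (hpull : ∀ k ∈ Finset.Icc 1 K, ∀ ω, A < k → T.RecentlyAccurate α Hi Lo 8 k ω →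
      Hi.IsOptimal (T.armHi k ω) ∨ pullBudget α A W k ≤ m) :
    T.regretHi P Hi K ≤ (m + 17) * Hi.invGapSum := by
  have hα0 : 0 ≤ α := by linarith
  obtain ⟨i, hi⟩ := hsub
  have hgood : ∀ ω, ∀ t ⊆ Finset.Icc 1 K,
      (∀ k ∈ t, ω ∉ {ω | ¬ T.RecentlyAccurate α Hi Lo 8 k ω}) →
      ∑ k ∈ t, Hi.gap (T.armHi k ω) ≤ (m + 1) * Hi.invGapSum := by
    intro ω t ht hacc
    refine sum_gap_le (arm := T.armHi) (ω := ω) hm fun k hk => ?_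
    have hk1 := (Finset.mem_Icc.1 (ht hk)).1
    refine ⟨hk1, ?_⟩
    rcases le_or_gt k A with hkA | hkA
    · rw [TriesEveryArm.pullCount_eq_zero (h.init_armHi ω) hk1 hkA, Nat.cast_zero, zero_mul]
      exact hm
    have hacck : T.RecentlyAccurate α Hi Lo 8 k ω := not_not.1 (hacc k hk)
    rcases hpull k (ht hk) ω hkA hacck with hopt | hbudget
    · rw [hopt.gap_eq_zero, zero_pow two_ne_zero, mul_zero]
      exact hm
    · exact (h.pullCount_mul_sq_gap_armHi_le hα0 hdom hε hkA
        (hacck.two_of_eight (by omega) le_rfl)).trans hbudget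
  calc T.regretHi P Hi K
      ≤ (m + 1) * Hi.invGapSum
        + ∑ k ∈ Finset.Icc 1 K, P.real {ω | ¬ T.RecentlyAccurate α Hi Lo 8 k ω} :=
        integral_sum_le_add_sum_measureReal (fun k ω => ⟨Hi.gap_nonneg _, Hi.gap_le_one _⟩) hgood
    _ ≤ (m + 1) * Hi.invGapSum + ∑ k ∈ Finset.Icc 1 K, 8 * (1 / (k : ℝ) ^ 2) := by
        gcongr with k hk
        exact h.measureReal_not_recentlyAccurate_le hα (Fin.pos i) hW (Finset.mem_Icc.1 hk).1
    _ ≤ (m + 1) * Hi.invGapSum + 8 * 2 := by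
        rw [← Finset.mul_sum]
        gcongr
        exact sum_inv_sq_le_two K
    _ ≤ (m + 17) * Hi.invGapSum := by linarith [BanditTask.one_le_invGapSum hi]

end IsTrustRun

end Probability

end TieredTrace

section Exploration

variable {A W k : ℕ} {α D : ℝ}

lemma log_confFn_le (hW : 2 ≤ W) (hk : A < k) :
    Real.log (confFn A W k) ≤ 11 * Real.log (W * k) := by
  have hk1 : (1 : ℝ) ≤ k := mod_cast (by omega : 1 ≤ k)
  have hW2 : (2 : ℝ) ≤ W := mod_cast hW
  have hAk : (A : ℝ) ≤ k := mod_cast hk.le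
  have hWk : (2 : ℝ) ≤ W * k := by nlinarith
  have hpow : (W : ℝ) * k ^ 4 ≤ (W * k) ^ 4 := by
    rw [mul_pow]
    gcongr
    exact le_self_pow₀ (by linarith) four_ne_zero
  have hconf : confFn A W k ≤ (W * k : ℝ) ^ 11 := by
    calc confFn A W k ≤ 1 + 16 * W * (k : ℝ) ^ 2 * (2 * k) ^ 2 := by
          unfold confFn
          gcongr
          linarith
      _ = 1 + 64 * (W * (k : ℝ) ^ 4) := by ring
      _ ≤ (W * k : ℝ) ^ 4 + 64 * (W * k) ^ 4 := by
          gcongr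
          exact one_le_pow₀ (by linarith)
      _ = 65 * (W * k : ℝ) ^ 4 := by ring
      _ ≤ 2 ^ 7 * (W * k : ℝ) ^ 4 := by gcongr; norm_num
      _ ≤ (W * k) ^ 7 * (W * k : ℝ) ^ 4 := by gcongr
      _ = (W * k : ℝ) ^ 11 := by ring
  calc Real.log (confFn A W k) ≤ Real.log ((W * k : ℝ) ^ 11) :=
        Real.log_le_log (zero_lt_one.trans_le (one_le_confFn A W k)) hconf
    _ = 11 * Real.log (W * k) := by rw [Real.log_pow, Nat.cast_ofNat]

lemma log_le_two_mul_sqrt {x : ℝ} (hx : 0 < x) : Real.log x ≤ 2 * √x := by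
  have hsqrt := Real.log_le_sub_one_of_pos (Real.sqrt_pos.2 hx)
  rw [Real.log_sqrt hx.le] at hsqrt
  linarith

lemma pullBudget_le_mul_log (hα : 0 ≤ α) (hW : 2 ≤ W) (hk : A < k) :
    pullBudget α A W k ≤ 35200 * α * Real.log (W * k) := by
  calc pullBudget α A W k ≤ 3200 * α * (11 * Real.log (W * k)) :=
        mul_le_mul_of_nonneg_left (log_confFn_le hW hk) (by positivity)
    _ = 35200 * α * Real.log (W * k) := by ring

lemma pullBudget_le_mul_sqrt (hα : 0 ≤ α) (hW : 2 ≤ W) (hk : A < k) :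
    pullBudget α A W k ≤ 70400 * α * (W * √k) := by
  have hk0 : (0 : ℝ) < k := Nat.cast_pos.2 (Nat.zero_lt_of_lt hk)
  have hW0 : (1 : ℝ) ≤ W := mod_cast (by omega : 1 ≤ W)
  calc pullBudget α A W k ≤ 35200 * α * Real.log (W * k) := pullBudget_le_mul_log hα hW hk
    _ ≤ 35200 * α * (2 * √(W * k)) := by
        gcongr
        exact log_le_two_mul_sqrt (by positivity)
    _ = 70400 * α * (√W * √k) := by rw [Real.sqrt_mul (by positivity)]; ring
    _ ≤ 70400 * α * (W * √k) := by
        gcongr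
        exact Real.sqrt_le_iff.2 ⟨by positivity, le_self_pow₀ hW0 two_ne_zero⟩

/- With `x = A W / D`, the left side of `PastExploration` is at most
`70400 α x² √k + A + 1 ≤ (70400 + 4) α x² √k`, and `8 * (70400 + 4) ≤ 10 ^ 6`. -/
lemma pastExploration_of_lt (hα : 1 / 2 ≤ α) (hA : 1 ≤ A) (hW : 2 ≤ W) (hD : 0 < D) (hD1 : D ≤ 1)
    (hk : (10 ^ 6 * α) ^ 2 * (A * W / D : ℝ) ^ 4 < k) : PastExploration α D A W k := by
  have hW2 : (2 : ℝ) ≤ W := mod_cast hW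
  have hA1 : (1 : ℝ) ≤ A := mod_cast hA
  set x : ℝ := A * W / D
  have hAx : (A : ℝ) ≤ x := (le_div_iff₀ hD).2 (by nlinarith)
  have hx2 : x ≤ x ^ 2 := le_self_pow₀ (hA1.trans hAx) two_ne_zero
  set s := √(k : ℝ)
  have hs2 : s ^ 2 = k := Real.sq_sqrt (Nat.cast_nonneg k)
  have hs : 10 ^ 6 * α * x ^ 2 < s := Real.lt_sqrt_of_sq_lt (by linarith)
  have hs1 : 1 ≤ s := by nlinarith
  have hkA : A < k := by
    have : (A : ℝ) < k := by rw [← hs2]; nlinarith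
    exact_mod_cast this
  have hbudget : A * (pullBudget α A W k / D ^ 2) ≤ 70400 * α * x ^ 2 * s := by
    calc A * (pullBudget α A W k / D ^ 2) ≤ A * (70400 * α * (W * s) / D ^ 2) := by
          gcongr
          exact pullBudget_le_mul_sqrt (by linarith) hW hkA
      _ = 70400 * α * (A * W / D ^ 2) * s := by ring
      _ ≤ 70400 * α * ((A * W) ^ 2 / D ^ 2) * s := by
          gcongr
          exact le_self_pow₀ (by nlinarith) two_ne_zero
      _ = 70400 * α * x ^ 2 * s := by rw [← div_pow]
  have hconst : (A : ℝ) + 1 ≤ 4 * α * x ^ 2 * s := by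
    calc (A : ℝ) + 1 ≤ 2 * x ^ 2 * 1 := by linarith
      _ ≤ 4 * α * x ^ 2 * s := by gcongr; linarith
  calc A * (pullBudget α A W k / D ^ 2 + 1) + 1
      ≤ 70404 * α * x ^ 2 * s := by linarith
    _ ≤ 10 ^ 6 * α * x ^ 2 * s / 8 := by
        have : 0 ≤ α * x ^ 2 * s := by positivity
        linarith
    _ < s * s / 8 := by gcongr
    _ = k / 8 := by rw [← hs2, sq]

lemma one_le_log_of_four_le {x : ℝ} (hx : 4 ≤ x) : 1 ≤ Real.log x := by
  calc (1 : ℝ) ≤ 2 * Real.log 2 := by linarith [Real.log_two_gt_d9]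
    _ = Real.log (2 ^ 2) := by rw [Real.log_pow, Nat.cast_ofNat]
    _ ≤ Real.log x := Real.log_le_log (by norm_num) (by linarith)

lemma log_million_mul_sq_nonneg (hα : 1 / 2 ≤ α) : 0 ≤ Real.log ((10 ^ 6 * α) ^ 2) :=
  Real.log_nonneg (one_le_pow₀ (by linarith))

lemma pullBudget_le_of_le (hα : 1 / 2 ≤ α) (hW : 2 ≤ W) (hk : A < k) {x : ℝ} (hx : 4 ≤ x)
    (hWx : W ≤ x) (hkx : k ≤ (10 ^ 6 * α) ^ 2 * x ^ 4) :
    pullBudget α A W k ≤ 35200 * α * (Real.log ((10 ^ 6 * α) ^ 2) + 5) * Real.log x := by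
  have hk0 : (0 : ℝ) < k := Nat.cast_pos.2 (Nat.zero_lt_of_lt hk)
  have : (0 : ℝ) < W := Nat.cast_pos.2 (by omega)
  have hc := log_million_mul_sq_nonneg hα
  have hlog : Real.log (W * k) ≤ (Real.log ((10 ^ 6 * α) ^ 2) + 5) * Real.log x := by
    calc Real.log (W * k) ≤ Real.log (x * ((10 ^ 6 * α) ^ 2 * x ^ 4)) := by gcongr
      _ = Real.log ((10 ^ 6 * α) ^ 2 * x ^ 5) := by congr 1; ring
      _ = Real.log ((10 ^ 6 * α) ^ 2) + 5 * Real.log x := by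
          rw [Real.log_mul (by positivity) (by positivity), Real.log_pow x, Nat.cast_ofNat]
      _ ≤ Real.log ((10 ^ 6 * α) ^ 2) * Real.log x + 5 * Real.log x := by
          gcongr
          exact le_mul_of_one_le_right hc (one_le_log_of_four_le hx)
      _ = (Real.log ((10 ^ 6 * α) ^ 2) + 5) * Real.log x := by ring
  calc pullBudget α A W k ≤ 35200 * α * Real.log (W * k) :=
        pullBudget_le_mul_log (by linarith) hW hk
    _ ≤ 35200 * α * ((Real.log ((10 ^ 6 * α) ^ 2) + 5) * Real.log x) := by gcongr
    _ = 35200 * α * (Real.log ((10 ^ 6 * α) ^ 2) + 5) * Real.log x := by ring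

end Exploration

namespace BanditTask

variable {A : ℕ} {M : BanditTask A} {i : Fin A}

lemma two_le_of_not_isOptimal (h : ¬ M.IsOptimal i) : 2 ≤ A := by
  have : Nonempty (Fin A) := ⟨i⟩
  obtain ⟨j, hj⟩ := M.exists_isOptimal
  exact Fin.nontrivial_iff_two_le.1 ⟨i, j, fun hij => h (hij ▸ hj)⟩

lemma invGapSum_eq_zero (h : ∀ i, M.IsOptimal i) : M.invGapSum = 0 :=
  Finset.sum_eq_zero fun i _ => by rw [(h i).gap_eq_zero, div_zero]

end BanditTask

/-- The constant of the regret bounds, for the confidence parameter `α`. -/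
noncomputable def trustConst (α : ℝ) : ℝ :=
  35200 * α * (Real.log ((10 ^ 6 * α) ^ 2) + 5) + 34

lemma trustConst_pos {α : ℝ} (hα : 1 / 2 ≤ α) : 0 < trustConst α := by
  have := log_million_mul_sq_nonneg hα
  unfold trustConst
  positivity

namespace TieredTrace

variable {A W : ℕ} {Ω : Type*} [MeasurableSpace Ω] {P : Measure Ω} {T : TieredTrace A W Ω}
  {α ε D : ℝ} {Hi : BanditTask A} {Lo : Fin W → BanditTask A} {K : ℕ}

lemma regretHi_eq_zero (h : ∀ i, Hi.IsOptimal i) (T : TieredTrace A W Ω) (P : Measure Ω) (K : ℕ) :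
    T.regretHi P Hi K = 0 := by
  simp only [regretHi, (h _).mean_eq, sub_self, Finset.sum_const_zero, integral_zero]

namespace IsTrustRun

variable [IsProbabilityMeasure P]

lemma regretHi_le_trustConst_mul (h : T.IsTrustRun P α ε Hi Lo) (hα : 1 / 2 ≤ α) (hW : 1 ≤ W)
    (hdom : BanditTask.OptValueDominance D Hi Lo) (hε : ε ≤ D / 4)
    (hsub : ∃ i, ¬ Hi.IsOptimal i) {l : ℝ} (hl : 1 / 2 ≤ l)
    (hpull : ∀ k ∈ Finset.Icc 1 K, ∀ ω, A < k → T.RecentlyAccurate α Hi Lo 8 k ω →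
      Hi.IsOptimal (T.armHi k ω) ∨
        pullBudget α A W k ≤ 35200 * α * (Real.log ((10 ^ 6 * α) ^ 2) + 5) * l) :
    T.regretHi P Hi K ≤ trustConst α * (Hi.invGapSum * l) := by
  have hlog := log_million_mul_sq_nonneg hα
  calc T.regretHi P Hi K
      ≤ (35200 * α * (Real.log ((10 ^ 6 * α) ^ 2) + 5) * l + 17) * Hi.invGapSum :=
        h.regretHi_le hα hW hdom hε hsub (by positivity) hpull
    _ ≤ (35200 * α * (Real.log ((10 ^ 6 * α) ^ 2) + 5) * l + 34 * l) * Hi.invGapSum := by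
        gcongr
        · exact Hi.invGapSum_nonneg
        · linarith
    _ = trustConst α * (Hi.invGapSum * l) := by rw [trustConst]; ring

lemma regretHi_le_log_mul (h : T.IsTrustRun P α ε Hi Lo) (hα : 1 / 2 ≤ α) (hW : 2 ≤ W)
    (hdom : BanditTask.OptValueDominance D Hi Lo) (hε : ε ≤ D / 4)
    (hsub : ∃ i, ¬ Hi.IsOptimal i) (hK : 1 ≤ K) :
    T.regretHi P Hi K ≤ trustConst α * (Hi.invGapSum * Real.log (W * K)) := by
  have hlog := log_million_mul_sq_nonneg hα
  have hWK : (2 : ℝ) ≤ W * K := mod_cast hW.trans (Nat.le_mul_of_pos_right W hK)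
  have hl : 1 / 2 ≤ Real.log (W * K) := by
    linarith [Real.log_two_gt_d9, Real.log_le_log zero_lt_two hWK]
  refine h.regretHi_le_trustConst_mul hα (by omega) hdom hε hsub hl fun k hk ω hkA _ => Or.inr ?_
  have hkK := (Finset.mem_Icc.1 hk).2
  calc pullBudget α A W k ≤ pullBudget α A W K := pullBudget_mono (by linarith) A W hkK
    _ ≤ 35200 * α * Real.log (W * K) :=
        pullBudget_le_mul_log (by linarith) hW (hkA.trans_le hkK)
    _ ≤ 35200 * α * (Real.log ((10 ^ 6 * α) ^ 2) + 5) * Real.log (W * K) := by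
        refine mul_le_mul_of_nonneg_right ?_ (by linarith)
        exact le_mul_of_one_le_right (by linarith) (by linarith)

lemma regretHi_le_log_div (h : T.IsTrustRun P α ε Hi Lo) (hα : 1 / 2 ≤ α) (hW : 2 ≤ W)
    (hdom : BanditTask.OptValueDominance D Hi Lo) (hε : ε ≤ D / 4)
    (hsub : ∃ i, ¬ Hi.IsOptimal i) (hHi : ∃! i, Hi.IsOptimal i) (hD : 0 < D)
    (hclose : ∃ w, BanditTask.IsClose ε Hi (Lo w) ∧ (Lo w).IsGapLowerBound D) (K : ℕ) :
    T.regretHi P Hi K ≤ trustConst α * (Hi.invGapSum * Real.log (A * W / D)) := by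
  obtain ⟨i, hi⟩ := hsub
  obtain ⟨w, hw, hgap⟩ := hclose
  have hD1 : D ≤ 1 := (hdom.isGapLowerBound i hi).trans (Hi.gap_le_one i)
  have hA := BanditTask.two_le_of_not_isOptimal hi
  have hA2 : (2 : ℝ) ≤ A := mod_cast hA
  have hW2 : (2 : ℝ) ≤ W := mod_cast hW
  have hx : (4 : ℝ) ≤ A * W / D := (le_div_iff₀ hD).2 (by nlinarith)
  have hWx : (W : ℝ) ≤ A * W / D := (le_div_iff₀ hD).2 (by nlinarith)
  have hl : 1 / 2 ≤ Real.log (A * W / D) := by linarith [one_le_log_of_four_le hx]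
  refine h.regretHi_le_trustConst_mul hα (by omega) hdom hε ⟨i, hi⟩ hl fun k _ ω hkA hacc => ?_
  rcases lt_or_ge ((10 ^ 6 * α) ^ 2 * (A * W / D : ℝ) ^ 4) (k : ℝ) with hlate | hearly
  · exact Or.inl (h.isOptimal_armHi (by linarith) hD hdom hε hHi hw hgap hacc
      (pastExploration_of_lt hα (by omega) hW hD hD1 hlate))
  · exact Or.inr (pullBudget_le_of_le hα hW hkA hx hWx hearly)

end IsTrustRun

end TieredTrace

theorem mainTheorem6_general (α : ℝ) (hα : 1 / 2 ≤ α) :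
    ∃ C : ℝ, 0 < C ∧
      ∀ (A W : ℕ), 2 ≤ W →
      ∀ (Hi : BanditTask A) (Lo : Fin W → BanditTask A) (D ε : ℝ),
        BanditTask.OptValueDominance D Hi Lo → ε ≤ D / 4 →
      ∀ (Ω : Type*) [MeasurableSpace Ω] (P : Measure Ω) [IsProbabilityMeasure P]
        (T : TieredTrace A W Ω), T.IsTrustRun P α ε Hi Lo →
        (∀ K : ℕ, 1 ≤ K →
          T.regretHi P Hi K ≤ C * (Hi.invGapSum * Real.log (W * K))) ∧
        ((∃! i, Hi.IsOptimal i) → 0 < D →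
          (∃ w, BanditTask.IsClose ε Hi (Lo w) ∧ (Lo w).IsGapLowerBound D) →
          ∀ K : ℕ, T.regretHi P Hi K ≤ C * (Hi.invGapSum * Real.log (A * W / D))) := by
  refine ⟨trustConst α, trustConst_pos hα, fun A W hW Hi Lo D ε hdom hε Ω _ P _ T h => ?_⟩
  by_cases hsub : ∃ i, ¬ Hi.IsOptimal i
  · exact ⟨fun K => h.regretHi_le_log_mul hα hW hdom hε hsub,
      h.regretHi_le_log_div hα hW hdom hε hsub⟩
  · have hopt : ∀ i, Hi.IsOptimal i := not_exists_not.1 hsub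
    simp only [TieredTrace.regretHi_eq_zero hopt, BanditTask.invGapSum_eq_zero hopt, zero_mul,
      mul_zero, le_refl, implies_true, and_self]

theorem mainTheorem6 (α : ℝ) (hα : 2 < α) :
    ∃ C : ℝ, 0 < C ∧
      ∀ (A W : ℕ), 2 ≤ A → 2 ≤ W →
      ∀ (Hi : BanditTask A) (Lo : Fin W → BanditTask A) (Δt : ℝ),
        (∃! i, Hi.IsOptimal i) → (∀ w, ∃! i, (Lo w).IsOptimal i) →
        (∀ w, Hi.optValue - BanditTask.jointMinGap Hi Lo / 2 ≤ (Lo w).optValue) →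
        0 ≤ Δt → Δt ≤ BanditTask.jointMinGap Hi Lo →
      ∀ (Ω : Type*) [MeasurableSpace Ω] (P : Measure Ω) [IsProbabilityMeasure P]
        (T : TieredTrace A W Ω), T.IsTrustRun P α (Δt / 4) Hi Lo →
        (∀ K : ℕ, 1 ≤ K →
          T.regretHi P Hi K ≤ C * (Hi.invGapSum * Real.log ((W : ℝ) * (K : ℝ)))) ∧
        ((∃ w, BanditTask.IsClose (Δt / 4) Hi (Lo w)) →
          ∀ K : ℕ, 1 ≤ K →
            T.regretHi P Hi K ≤
              C * (Hi.invGapSum *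
                Real.log ((A : ℝ) * (W : ℝ) / BanditTask.jointMinGap Hi Lo))) := by
  obtain ⟨C, hC, hregret⟩ := mainTheorem6_general α (by linarith)
  refine ⟨C, hC, fun A W hA hW Hi Lo Δt hHi hLo hdom _ hΔ Ω _ P _ T h => ?_⟩
  have : Nonempty (Fin W) := ⟨⟨0, by omega⟩⟩
  have hpos : 0 < BanditTask.jointMinGap Hi Lo := BanditTask.jointMinGap_pos
    (BanditTask.exists_not_isOptimal hA hHi) fun w => BanditTask.exists_not_isOptimal hA (hLo w)
  obtain ⟨hlog, hconst⟩ := hregret A W hW Hi Lo _ _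
    ⟨BanditTask.isGapLowerBound_jointMinGap Hi Lo, hdom⟩ (by linarith) Ω P T h
  exact ⟨hlog, fun ⟨w, hw⟩ K _ =>
    hconst hHi hpos ⟨w, hw, BanditTask.isGapLowerBound_jointMinGap_source Hi Lo w⟩ K⟩
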